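/- **Setting.** Fix $\Delta\in\mathbb N$ and linear codes $C_A,C_B\subseteq\mathbb F_2^\Delta$ with full-row-rank parity-check matrices $H_A\in\mathbb F_2^{m_a\times\Delta}$, $H_B\in\mathbb F_2^{m_b\times\Delta}$, and let $H_A^\perp\in\mathbb F_2^{k_a\times\Delta}$, $H_B^\perp\in\mathbb F_2^{k_b\times\Delta}$ be full-row-rank parity-check matrices of the dual codes $C_A^\perp,C_B^\perp$. Let $d_2>0$ be such that $(C_A,C_B)$ is $d_2$-robust: every $c\in C_A\otimes\mathbb F_2^\Delta+\mathbb F_2^\Delta\otimes C_B\subseteq\mathbb F_2^{\Delta\times\Delta}$ can be written $c=c_a+c_b$, where all columns of $c_a$ lie in $C_A$, all rows of $c_b$ lie in $C_B$, and $$|c|\ \ge\ d_2\big(\#\{\text{non-zero columns of }c_a\}+\#\{\text{non-zero rows of }c_b\}\big),$$ $|c|$ being the number of non-zero entries of $c$. For a finite group $G$ with inverse-closed generating sets $A,B$ of size $\Delta$ (each identified with $\{1,\dots,\Delta\}$), the 4-fold left-right Cayley complex $\mathcal G_2=\mathcal G_2(G,A,B)$ has vertices $V=V_{00}\cup V_{10}\cup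 V_{01}\cup V_{11}$, four disjoint copies of $G$; vertical edges $E^|$, namely $(g,ag)$ from $V_{00}$ to $V_{10}$ and from $V_{01}$ to $V_{11}$; horizontal edges $E^-$, namely $(g,gb)$ from $V_{00}$ to $V_{01}$ and from $V_{10}$ to $V_{11}$; and faces $F=\{(g,ag,gb,agb)\}\subseteq V_{00}\times V_{10}\times V_{01}\times V_{11}$ ($g\in G$, $a\in A$, $b\in B$). The chain complex $$X(\mathcal G_2,C_A,C_B):\ \mathbb F_2^F\xrightarrow{\ \partial_2\ }(\mathbb F_2^{m_a})^{E^-}\oplus(\mathbb F_2^{m_b})^{E^|}\xrightarrow{\ \partial_1\ }(\mathbb F_2^{m_a\times m_b})^V$$ sends a face $(g,ag,gb,agb)$ to the $a$-th column of $H_A$ on each of its two horizontal edges and the $b$-th column of $H_B$ on each of its two vertical edges; it sends $x\in\mathbb F_2^{m_a}$ on a horizontal edge with label $b$ to $x\otimes H_B(b)$ on both endpoints, and $y\in\mathbb F_2^{m_b}$ on a vertical edge with label $a$ to $H_A(a)\otimes y$ on both endpoints. The complex $X(\mathcal G_2,C_A^\perp,C_B^\perp)$ is defined in the same way from $H_A^\perp,H_B^\perp$.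 Put $\delta^0=\partial_1^T$ and $\delta^1=\partial_2^T$, and let $\|c\|_E$ be the number of edges on which a 1-(co)chain $c$ is non-zero. Consider any family of such triples $(G,A,B)$, each with a numbering of $G$ by $0,\dots,|G|-1$; $\Delta$ and the local codes are fixed. A *linear-time decoder up to distance* $\eta|G|$ for the family of complexes $X$ is a single word-RAM program (unit cost per operation, words of $O(\log|G|)$ bits) which, for every member of the family and every 1-chain $c_1$ with $\|c_1\|_E\le\eta|G|$, given $|G|$, the tables of $(a,g)\mapsto ag$ and $(b,g)\mapsto gb$, and the syndrome $\partial_1c_1$, halts after $O(|G|)$ steps with an output in $c_1+\operatorname{im}\partial_2$. A *linear-time co-decoder* is defined in the same way, with syndrome $\delta^1c^1$ and an output in $c^1+\operatorname{im}\delta^0$. The constants in $O(\cdot)$ are uniform over the family. **Theorem (Co-Decoder → Decoder).** Let $\eta''\in\mathbb R$. If the family $X(\mathcal G_2,C_A^\perp,C_B^\perp)$ has a linear-time co-decoder up to distance $\eta''|G|$, then the family $X(\mathcal G_2,C_A,C_B)$ has a linear-time decoder up to distance $$\frac{\eta''}{6+4\Delta/d_2}\,|G| .$$ -/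

import Mathlib

/-! ### Local codes: duality, parity-check matrices, tensor codes, robustness -/

/-- The dual code for the standard bilinear form on `𝔽₂ⁿ`. -/
def dualCode {n : ℕ} (C : Submodule (ZMod 2) (Fin n → ZMod 2)) :
    Submodule (ZMod 2) (Fin n → ZMod 2) where
  carrier := {x | ∀ y ∈ C, x ⬝ᵥ y = 0}
  add_mem' := by
    intro x x' hx hx' y hy
    rw [add_dotProduct, hx y hy, hx' y hy, add_zero]
  zero_mem' := by
    intro y _
    exact zero_dotProduct y
  smul_mem' := by
    intro r x hx y hy
    rw [smul_dotProduct, hx y hy, smul_zero]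

/-- `H : 𝔽₂ⁿ → 𝔽₂ᵐ` is a parity-check matrix of `C`: the code is its kernel, and its rows are
linearly independent (so that `m = n - dim C`). -/
def IsParityCheck {m n : ℕ} (H : Matrix (Fin m) (Fin n) (ZMod 2))
    (C : Submodule (ZMod 2) (Fin n → ZMod 2)) : Prop :=
  (∀ x, x ∈ C ↔ H.mulVec x = 0) ∧ LinearIndependent (ZMod 2) (fun i => H i)

/-- `C_A ⊗ C_B`: the matrices all of whose columns lie in `C_A` and all of whose rows lie in
`C_B`. -/
def tensorCode {na nb : ℕ} (CA : Submodule (ZMod 2) (Fin na → ZMod 2))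
    (CB : Submodule (ZMod 2) (Fin nb → ZMod 2)) :
    Submodule (ZMod 2) (Matrix (Fin na) (Fin nb) (ZMod 2)) where
  carrier := {c | (∀ j, (fun i => c i j) ∈ CA) ∧ ∀ i, (fun j => c i j) ∈ CB}
  add_mem' := fun hx hy =>
    ⟨fun j => CA.add_mem (hx.1 j) (hy.1 j), fun i => CB.add_mem (hx.2 i) (hy.2 i)⟩
  zero_mem' := ⟨fun _ => CA.zero_mem, fun _ => CB.zero_mem⟩
  smul_mem' := fun r _ hx => ⟨fun j => CA.smul_mem r (hx.1 j), fun i => CB.smul_mem r (hx.2 i)⟩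

/-- `Σ(C_A, C_B) = C_A ⊗ 𝔽₂^{n_b} + 𝔽₂^{n_a} ⊗ C_B`. -/
def tensorSum {na nb : ℕ} (CA : Submodule (ZMod 2) (Fin na → ZMod 2))
    (CB : Submodule (ZMod 2) (Fin nb → ZMod 2)) :
    Submodule (ZMod 2) (Matrix (Fin na) (Fin nb) (ZMod 2)) :=
  tensorCode CA ⊤ ⊔ tensorCode ⊤ CB

/-- The number of non-zero entries. -/
noncomputable def entryWeight {na nb : ℕ} (c : Matrix (Fin na) (Fin nb) (ZMod 2)) : ℕ :=
  Set.ncard {p : Fin na × Fin nb | c p.1 p.2 ≠ 0}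

/-- The number of non-zero columns. -/
noncomputable def colWeight {na nb : ℕ} (c : Matrix (Fin na) (Fin nb) (ZMod 2)) : ℕ :=
  Set.ncard {j : Fin nb | ∃ i, c i j ≠ 0}

/-- The number of non-zero rows. -/
noncomputable def rowWeight {na nb : ℕ} (c : Matrix (Fin na) (Fin nb) (ZMod 2)) : ℕ :=
  Set.ncard {i : Fin na | ∃ j, c i j ≠ 0}

/-- The pair `(C_A, C_B)` is `d₂`-robust. -/
def IsRobust {na nb : ℕ} (CA : Submodule (ZMod 2) (Fin na → ZMod 2))
    (CB : Submodule (ZMod 2) (Fin nb → ZMod 2)) (d₂ : ℝ) : Prop :=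
  ∀ c ∈ tensorSum CA CB, ∃ ca ∈ tensorCode CA ⊤, ∃ cb ∈ tensorCode ⊤ CB,
    c = ca + cb ∧ d₂ * ((colWeight ca : ℝ) + (rowWeight cb : ℝ)) ≤ (entryWeight c : ℝ)

/-! ### The 4-fold left-right Cayley complex and its chain complex -/

universe u

/-- A finite group `G` with two inverse-closed generating sets
`A = {a 0, …, a (Δ-1)}` and `B = {b 0, …, b (Δ-1)}` of size `Δ`, and a numbering of `G`. -/
structure LRCayley (Δ : ℕ) where
  G : Type u
  [group : Group G]
  [fintype : Fintype G]
  a : Fin Δ → G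
  b : Fin Δ → G
  a_injective : Function.Injective a
  b_injective : Function.Injective b
  a_inv : ∀ s, ∃ s', a s' = (a s)⁻¹
  b_inv : ∀ t, ∃ t', b t' = (b t)⁻¹
  a_generates : Subgroup.closure (Set.range a) = ⊤
  b_generates : Subgroup.closure (Set.range b) = ⊤
  idx : G ≃ Fin (Fintype.card G)

attribute [instance] LRCayley.group LRCayley.fintype

namespace LRCayley

variable {Δ : ℕ} (X : LRCayley.{u} Δ) {ma mb : ℕ}

/-- The order of the group. -/
def order : ℕ := Fintype.card X.G

/-- `(i, j, g)` is the vertex `g` of `V_{ij}`. -/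
abbrev Vertex : Type u := Bool × Bool × X.G

/-- Horizontal edges: `(i, g, t)` is the edge `(g, g b_t)` of `E_{i*} ⊆ V_{i0} × V_{i1}`. -/
abbrev HEdge : Type u := Bool × X.G × Fin Δ

/-- Vertical edges: `(j, g, s)` is the edge `(g, a_s g)` of `E_{*j} ⊆ V_{0j} × V_{1j}`. -/
abbrev VEdge : Type u := Bool × X.G × Fin Δ

/-- `(g, s, t)` is the face `(g, a_s g, g b_t, a_s g b_t)`. -/
abbrev Face : Type u := X.G × Fin Δ × Fin Δ

/-- The two endpoints (`k = 0, 1`) of a horizontal edge. -/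
def hEnd (k : Bool) (e : X.HEdge) : X.Vertex :=
  (e.1, k, if k then e.2.1 * X.b e.2.2 else e.2.1)

/-- The two endpoints (`k = 0, 1`) of a vertical edge. -/
def vEnd (k : Bool) (e : X.VEdge) : X.Vertex :=
  (k, e.1, if k then X.a e.2.2 * e.2.1 else e.2.1)

/-- The two horizontal sides of a face, in `E_{0*}` and `E_{1*}`. -/
def hSide (k : Bool) (f : X.Face) : X.HEdge :=
  (k, if k then X.a f.2.1 * f.1 else f.1, f.2.2)

/-- The two vertical sides of a face, in `E_{*0}` and `E_{*1}`. -/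
def vSide (k : Bool) (f : X.Face) : X.VEdge :=
  (k, if k then f.1 * X.b f.2.2 else f.1, f.2.1)

/-- The index set `X(1)`, so that `𝔽₂^{X(1)} = (𝔽₂^{m_a})^{E⁻} ⊕ (𝔽₂^{m_b})^{E^|}`. -/
abbrev EdgeBit (ma mb : ℕ) : Type u := (X.HEdge × Fin ma) ⊕ (X.VEdge × Fin mb)

/-- The index set `X(0)`, so that `𝔽₂^{X(0)} = (𝔽₂^{m_a × m_b})^V`. -/
abbrev VertexBit (ma mb : ℕ) : Type u := X.Vertex × Fin ma × Fin mb

open Classical in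
/-- The matrix of `∂₂ : 𝔽₂^F → (𝔽₂^{m_a})^{E⁻} ⊕ (𝔽₂^{m_b})^{E^|}`. The face `(g, s, t)`
contributes column `s` of `H_A` to each of its horizontal sides and column `t` of `H_B` to each
of its vertical sides. -/
noncomputable def bdry2 (HA : Matrix (Fin ma) (Fin Δ) (ZMod 2))
    (HB : Matrix (Fin mb) (Fin Δ) (ZMod 2)) : Matrix (X.EdgeBit ma mb) X.Face (ZMod 2) :=
  Matrix.of fun x f =>
    match x with
    | Sum.inl (e, p) => if ∃ k, X.hSide k f = e then HA p f.2.1 else 0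
    | Sum.inr (e, q) => if ∃ k, X.vSide k f = e then HB q f.2.2 else 0

open Classical in
/-- The matrix of `∂₁ : (𝔽₂^{m_a})^{E⁻} ⊕ (𝔽₂^{m_b})^{E^|} → (𝔽₂^{m_a × m_b})^V`. A horizontal
edge with label `t` and value `x` contributes `x ⊗ H_B(t)` to each endpoint; a vertical edge with
label `s` and value `y` contributes `H_A(s) ⊗ y` to each endpoint. -/
noncomputable def bdry1 (HA : Matrix (Fin ma) (Fin Δ) (ZMod 2))
    (HB : Matrix (Fin mb) (Fin Δ) (ZMod 2)) :
    Matrix (X.VertexBit ma mb) (X.EdgeBit ma mb) (ZMod 2) :=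
  Matrix.of fun y x =>
    match x with
    | Sum.inl (e, p) => if (∃ k, X.hEnd k e = y.1) ∧ p = y.2.1 then HB y.2.2 e.2.2 else 0
    | Sum.inr (e, q) => if (∃ k, X.vEnd k e = y.1) ∧ q = y.2.2 then HA y.2.1 e.2.2 else 0

/-- `‖c‖_E`: the number of edges on which a 1-(co)chain is non-zero. -/
noncomputable def edgeWeight (c : X.EdgeBit ma mb → ZMod 2) : ℕ :=
  Set.ncard {e : X.HEdge | ∃ p, c (Sum.inl (e, p)) ≠ 0} +
    Set.ncard {e : X.VEdge | ∃ q, c (Sum.inr (e, q)) ≠ 0}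

end LRCayley

/-! ### A word RAM: structured programs over registers and arrays, with a step count -/

namespace RAM

/-- Memory: registers `reg x`, and arrays `mem m` with cells `mem m i`. -/
structure State where
  reg : ℕ → ℕ
  mem : ℕ → ℕ → ℕ

/-- Arithmetic and comparison operations of the machine. -/
inductive Op where
  | add
  | sub
  | mul
  | div
  | mod
  | lt
  | eq

/-- The value of an operation (truncated subtraction, `x / 0 = 0`, comparisons give `0` or `1`). -/
def Op.apply : Op → ℕ → ℕ → ℕ
  | .add, x, y => x + y
  | .sub, x, y => x - y
  | .mul, x, y => x * y
  | .div, x, y => x / y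
  | .mod, x, y => x % y
  | .lt, x, y => if x < y then 1 else 0
  | .eq, x, y => if x = y then 1 else 0

/-- Expressions: constants, registers, array cells, operations. -/
inductive Expr where
  | lit (v : ℕ)
  | get (x : ℕ)
  | read (m : ℕ) (e : Expr)
  | bin (o : Op) (e₁ e₂ : Expr)

/-- The value of an expression. -/
def Expr.eval (s : State) : Expr → ℕ
  | .lit v => v
  | .get x => s.reg x
  | .read m e => s.mem m (e.eval s)
  | .bin o e₁ e₂ => o.apply (e₁.eval s) (e₂.eval s)

/-- The number of elementary operations in the evaluation of an expression. -/
def Expr.cost : Expr → ℕ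
  | .lit _ => 1
  | .get _ => 1
  | .read _ e => e.cost + 1
  | .bin _ e₁ e₂ => e₁.cost + e₂.cost + 1

/-- Every value met in the evaluation is a machine word, i.e. is smaller than `W`. -/
def Expr.Fits (W : ℕ) (s : State) : Expr → Prop
  | .lit v => v < W
  | .get x => s.reg x < W
  | .read m e => e.Fits W s ∧ s.mem m (e.eval s) < W
  | .bin o e₁ e₂ => e₁.Fits W s ∧ e₂.Fits W s ∧ o.apply (e₁.eval s) (e₂.eval s) < W

/-- Programs. -/
inductive Cmd where
  | skip
  | assign (x : ℕ) (e : Expr)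
  | store (m : ℕ) (i e : Expr)
  | seq (c₁ c₂ : Cmd)
  | cond (e : Expr) (c₁ c₂ : Cmd)
  | loop (e : Expr) (c : Cmd)

/-- `Run W c s s' t`: started in `s`, the program `c` halts in `s'` after `t` steps, and all values
computed on the way are smaller than `W`. A program that exceeds this bound has no run. -/
inductive Run (W : ℕ) : Cmd → State → State → ℕ → Prop where
  | skip (s : State) : Run W .skip s s 1
  | assign (s : State) (x : ℕ) (e : Expr) (he : e.Fits W s) :
      Run W (.assign x e) s ⟨Function.update s.reg x (e.eval s), s.mem⟩ (e.cost + 1)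
  | store (s : State) (m : ℕ) (i e : Expr) (hi : i.Fits W s) (he : e.Fits W s) :
      Run W (.store m i e) s
        ⟨s.reg, Function.update s.mem m (Function.update (s.mem m) (i.eval s) (e.eval s))⟩
        (i.cost + e.cost + 1)
  | seq {c₁ c₂ : Cmd} {s s₁ s₂ : State} {t₁ t₂ : ℕ}
      (h₁ : Run W c₁ s s₁ t₁) (h₂ : Run W c₂ s₁ s₂ t₂) : Run W (.seq c₁ c₂) s s₂ (t₁ + t₂)
  | cond_true {e : Expr} {c₁ c₂ : Cmd} {s s' : State} {t : ℕ} (he : e.Fits W s)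
      (h : e.eval s ≠ 0) (h₁ : Run W c₁ s s' t) : Run W (.cond e c₁ c₂) s s' (e.cost + 1 + t)
  | cond_false {e : Expr} {c₁ c₂ : Cmd} {s s' : State} {t : ℕ} (he : e.Fits W s)
      (h : e.eval s = 0) (h₂ : Run W c₂ s s' t) : Run W (.cond e c₁ c₂) s s' (e.cost + 1 + t)
  | loop_true {e : Expr} {c : Cmd} {s s₁ s₂ : State} {t₁ t₂ : ℕ} (he : e.Fits W s)
      (h : e.eval s ≠ 0) (h₁ : Run W c s s₁ t₁) (h₂ : Run W (.loop e c) s₁ s₂ t₂) :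
      Run W (.loop e c) s s₂ (e.cost + 1 + t₁ + t₂)
  | loop_false {e : Expr} {c : Cmd} {s : State} (he : e.Fits W s) (h : e.eval s = 0) :
      Run W (.loop e c) s s (e.cost + 1)

end RAM

/-! ### Input and output conventions, linear-time decoders and co-decoders -/

namespace LRCayley

variable {Δ : ℕ} (X : LRCayley.{u} Δ) {ma mb : ℕ}

/-- Cell of the pair `(g, s)` in a `|G| × Δ` table. -/
def tableCell (x : X.G × Fin Δ) : ℕ := (X.idx x.1 : ℕ) * Δ + x.2

/-- Cell of a face. -/
def faceCell (f : X.Face) : ℕ := ((X.idx f.1 : ℕ) * Δ + f.2.1) * Δ + f.2.2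

/-- Cell of the bit `p` of an edge of one of the two kinds, with `m` bits per edge. -/
def edgeCell (m : ℕ) (x : (Bool × X.G × Fin Δ) × Fin m) : ℕ :=
  ((x.1.1.toNat * X.order + X.idx x.1.2.1) * Δ + x.1.2.2) * m + x.2

/-- Cell of the bit `(p, q)` of a vertex. -/
def vertexCell (y : X.VertexBit ma mb) : ℕ :=
  (((2 * y.1.1.toNat + y.1.2.1.toNat) * X.order + X.idx y.1.2.2) * ma + y.2.1) * mb + y.2.2

/-- The initial memory on input the complex and an array `w`: register `0` holds `|G|`; array `0`
holds the table of `a_s g`, array `1` the table of `g b_t` (group elements given by their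
numbers), array `2` holds `w`; every other register and cell is `0`. -/
noncomputable def start (w : ℕ → ℕ) : RAM.State where
  reg := fun x => if x = 0 then X.order else 0
  mem := fun m =>
    match m with
    | 0 => Function.extend X.tableCell (fun x => (X.idx (X.a x.2 * x.1) : ℕ)) (fun _ => 0)
    | 1 => Function.extend X.tableCell (fun x => (X.idx (x.1 * X.b x.2) : ℕ)) (fun _ => 0)
    | 2 => w
    | _ => fun _ => 0

/-- The array that holds the bits of a 2-(co)chain. -/
noncomputable def faceArray (c : X.Face → ZMod 2) : ℕ → ℕ :=
  Function.extend X.faceCell (fun f => (c f).val) (fun _ => 0)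

/-- The array that holds the bits of a 0-(co)chain. -/
noncomputable def vertexArray (c : X.VertexBit ma mb → ZMod 2) : ℕ → ℕ :=
  Function.extend X.vertexCell (fun y => (c y).val) (fun _ => 0)

/-- The final memory holds the bits of the 1-(co)chain `c`: those of the horizontal edges in
array `3`, those of the vertical edges in array `4`. -/
def Outputs (σ : RAM.State) (c : X.EdgeBit ma mb → ZMod 2) : Prop :=
  (∀ x : X.HEdge × Fin ma, σ.mem 3 (X.edgeCell ma x) = (c (Sum.inl x)).val) ∧
    ∀ x : X.VEdge × Fin mb, σ.mem 4 (X.edgeCell mb x) = (c (Sum.inr x)).val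

end LRCayley

/-- The family of complexes `X(𝒢₂, C_A, C_B)` (with `H_A`, `H_B` the parity-check matrices of the
local codes) has a linear-time co-decoder up to distance `r`: one program on words of
`O(log |G|)` bits which, for every member of the family and every `c ∈ 𝔽₂^{X(1)}` with
`‖c‖_E ≤ r`, on input the complex and the syndrome `δ¹ c` halts after `O(|G|)` steps with an output
in `c + B¹ = c + im δ⁰`. Here `δ¹ = ∂₂ᵀ` and `δ⁰ = ∂₁ᵀ`. -/
def HasLinearTimeCoDecoder {Δ ma mb : ℕ} {ι : Type*} (X : ι → LRCayley.{u} Δ)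
    (HA : Matrix (Fin ma) (Fin Δ) (ZMod 2)) (HB : Matrix (Fin mb) (Fin Δ) (ZMod 2))
    (r : ι → ℝ) : Prop :=
  ∃ (P : RAM.Cmd) (K : ℕ), ∀ (i : ι) (c : (X i).EdgeBit ma mb → ZMod 2),
    ((X i).edgeWeight c : ℝ) ≤ r i →
      ∃ (σ : RAM.State) (t : ℕ),
        RAM.Run (((X i).order + 1) ^ K) P
          ((X i).start ((X i).faceArray (((X i).bdry2 HA HB).transpose.mulVec c))) σ t ∧
        t ≤ K * (X i).order ∧
        ∃ c' : (X i).EdgeBit ma mb → ZMod 2, (X i).Outputs σ c' ∧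
          ∃ z : (X i).VertexBit ma mb → ZMod 2,
            c' = c + ((X i).bdry1 HA HB).transpose.mulVec z

/-- The family of complexes `X(𝒢₂, C_A, C_B)` has a linear-time decoder up to distance `r`: one
program on words of `O(log |G|)` bits which, for every member of the family and every
`c ∈ 𝔽₂^{X(1)}` with `‖c‖_E ≤ r`, on input the complex and the syndrome `∂₁ c` halts after
`O(|G|)` steps with an output in `c + B₁ = c + im ∂₂`. -/
def HasLinearTimeDecoder {Δ ma mb : ℕ} {ι : Type*} (X : ι → LRCayley.{u} Δ)
    (HA : Matrix (Fin ma) (Fin Δ) (ZMod 2)) (HB : Matrix (Fin mb) (Fin Δ) (ZMod 2))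
    (r : ι → ℝ) : Prop :=
  ∃ (P : RAM.Cmd) (K : ℕ), ∀ (i : ι) (c : (X i).EdgeBit ma mb → ZMod 2),
    ((X i).edgeWeight c : ℝ) ≤ r i →
      ∃ (σ : RAM.State) (t : ℕ),
        RAM.Run (((X i).order + 1) ^ K) P
          ((X i).start ((X i).vertexArray (((X i).bdry1 HA HB).mulVec c))) σ t ∧
        t ≤ K * (X i).order ∧
        ∃ c' : (X i).EdgeBit ma mb → ZMod 2, (X i).Outputs σ c' ∧
          ∃ z : (X i).Face → ZMod 2, c' = c + ((X i).bdry2 HA HB).mulVec z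

/-! ### Generic facts about the word RAM -/

namespace RAM

/-! Write `x` and `y` for the horizontal and vertical parts of the error `c`. At a vertex the
syndrome is `x * HBᵀ + HA * y`. With right inverses `RA`, `RB` of the parity checks, the lift `L =
RA * x + y * RBᵀ` is a matrix on the faces at the vertex with that syndrome. The decoder does not
know `L`. It takes a matrix of least weight with the same syndrome, and this differs from `L` by
some `ca + cb` with columns of `ca` in `C_A` and rows of `cb` in `C_B`. Robustness bounds the number
of non-zero columns and rows by `2Δ/d₂` times the number of error edges at the vertex
(`exists_local_decoder`).

Now add the local guesses over the four corners of each face. Both ends of an edge use the same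
lift, so all lifts cancel in characteristic 2, and only the codewords `ca`, `cb` remain. The two
columns that meet at a horizontal edge add up to a word of `C_A`, which is the row space of `HA'`;
vertical edges behave alike. Hence the sum is `δ¹ c'` for a cochain `c'` of the dual-code complex.
Double counting (`sum_view_weight`, `edgeWeight_le_sum`) gives `‖c'‖ ≤ (4Δ/d₂) ‖c‖`, so the
co-decoder applies and returns some `c' + δ⁰ z`.

This answer makes neighbouring guesses consistent: correcting the guess at `V₀₀` by it transports it
to the other corners, up to local words that the parity checks kill. Reading off edge values gives
`c + ∂₂ w`, where `w` consists of the unknown lift on `E_{*0}`, the words `cb` at `V₁₀`, and a term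
in `C_A ⊗ C_B` from `z` (`exists_decoder`).

On the machine every step except the co-decoder is a loop over `G` with a body of constant size,
because `Δ` and the local codes are fixed (`fill_run`, `Expr.exists_bool`). The co-decoder runs
unchanged beside private registers and arrays, by `Run.frame`. -/

theorem Expr.Fits.eval_lt {W : ℕ} {s : State} {e : Expr} (h : e.Fits W s) : e.eval s < W := by
  cases e with
  | lit v => exact h
  | get x => exact h
  | read m e => exact h.2
  | bin o e₁ e₂ => exact h.2.2

theorem Expr.Fits.mono {W W' : ℕ} (hW : W ≤ W') {s : State} {e : Expr} (h : e.Fits W s) :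
    e.Fits W' s := by
  induction e with
  | lit v => exact lt_of_lt_of_le h hW
  | get x => exact lt_of_lt_of_le h hW
  | read m e ih => exact ⟨ih h.1, lt_of_lt_of_le h.2 hW⟩
  | bin o e₁ e₂ ih₁ ih₂ => exact ⟨ih₁ h.1, ih₂ h.2.1, lt_of_lt_of_le h.2.2 hW⟩

theorem Run.mono {W W' : ℕ} (hW : W ≤ W') {c : Cmd} {s s' : State} {t : ℕ}
    (h : Run W c s s' t) : Run W' c s s' t := by
  induction h with
  | skip s => exact .skip s
  | assign s x e he => exact .assign s x e (he.mono hW)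
  | store s m i e hi he => exact .store s m i e (hi.mono hW) (he.mono hW)
  | seq _ _ ih₁ ih₂ => exact .seq ih₁ ih₂
  | cond_true he h _ ih => exact .cond_true (he.mono hW) h ih
  | cond_false he h _ ih => exact .cond_false (he.mono hW) h ih
  | loop_true he h _ _ ih₁ ih₂ => exact .loop_true (he.mono hW) h ih₁ ih₂
  | loop_false he h => exact .loop_false (he.mono hW) h

/-! ### Bounds on memory contents -/

/-- All registers and cells hold values smaller than `B`. -/
def Bounded (B : ℕ) (s : State) : Prop :=
  (∀ x, s.reg x < B) ∧ ∀ m i, s.mem m i < B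

theorem Bounded.mono {B B' : ℕ} (hB : B ≤ B') {s : State} (h : Bounded B s) : Bounded B' s :=
  ⟨fun x => lt_of_lt_of_le (h.1 x) hB, fun m i => lt_of_lt_of_le (h.2 m i) hB⟩

theorem Bounded.assign {B : ℕ} {s : State} (h : Bounded B s) (x : ℕ) {v : ℕ} (hv : v < B) :
    Bounded B ⟨Function.update s.reg x v, s.mem⟩ := by
  refine ⟨fun y => ?_, h.2⟩
  by_cases hy : y = x
  · subst hy; simpa using hv
  · simpa [hy] using h.1 y

theorem Bounded.store {B : ℕ} {s : State} (h : Bounded B s) (m i : ℕ) {v : ℕ} (hv : v < B) :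
    Bounded B ⟨s.reg, Function.update s.mem m (Function.update (s.mem m) i v)⟩ := by
  refine ⟨h.1, fun m' i' => ?_⟩
  by_cases hm : m' = m
  · subst hm
    by_cases hi : i' = i
    · subst hi; simpa using hv
    · simpa [hi] using h.2 m' i'
  · simpa [hm] using h.2 m' i'

/-- Whatever is written has passed a `Fits` test. This is the only control over the memory that the
unknown co-decoder leaves behind. -/
theorem Run.bounded {W : ℕ} {c : Cmd} {s s' : State} {t : ℕ} (h : Run W c s s' t)
    (hs : Bounded W s) : Bounded W s' := by
  induction h with
  | skip s => exact hs
  | assign s x e he => exact hs.assign x he.eval_lt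
  | store s m i e hi he => exact hs.store m _ he.eval_lt
  | seq _ _ ih₁ ih₂ => exact ih₂ (ih₁ hs)
  | cond_true _ _ _ ih => exact ih hs
  | cond_false _ _ _ ih => exact ih hs
  | loop_true _ _ _ _ ih₁ ih₂ => exact ih₂ (ih₁ hs)
  | loop_false _ _ => exact hs

/-- An exponent that bounds all values met in the evaluation of an expression in memories with
values below `(n + 1) ^ k`. -/
def Expr.deg (k : ℕ) : Expr → ℕ
  | .lit v => v
  | .get _ => k
  | .read _ e => max k (e.deg k)
  | .bin _ e₁ e₂ => e₁.deg k + e₂.deg k + 1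

/-- The additional exponent pays for a factor `2 ≤ n + 1`, which sums and the value `1` of a
comparison need. -/
theorem Op.apply_lt {n a b x y : ℕ} (hn : 1 ≤ n) (o : Op) (hx : x < (n + 1) ^ a)
    (hy : y < (n + 1) ^ b) : o.apply x y < (n + 1) ^ (a + b + 1) := by
  have ha : 1 ≤ (n + 1) ^ a := Nat.one_le_pow _ _ (by omega)
  have hb : 1 ≤ (n + 1) ^ b := Nat.one_le_pow _ _ (by omega)
  have h1 : (n + 1) ^ a * (n + 1) ^ b * 2 ≤ (n + 1) ^ (a + b + 1) := by
    rw [pow_succ, pow_add]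
    exact Nat.mul_le_mul_left _ (by omega)
  have h2 : (n + 1) ^ a ≤ (n + 1) ^ a * (n + 1) ^ b := Nat.le_mul_of_pos_right _ hb
  have h3 : (n + 1) ^ b ≤ (n + 1) ^ a * (n + 1) ^ b := Nat.le_mul_of_pos_left _ ha
  cases o with
  | add => simp only [Op.apply]; omega
  | sub => simp only [Op.apply]; omega
  | mul =>
    have : x * y < (n + 1) ^ a * (n + 1) ^ b := Nat.mul_lt_mul'' hx hy
    simp only [Op.apply]; omega
  | div => have := Nat.div_le_self x y; simp only [Op.apply]; omega
  | mod => have := Nat.mod_le x y; simp only [Op.apply]; omega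
  | lt => simp only [Op.apply]; split <;> omega
  | eq => simp only [Op.apply]; split <;> omega

/-- The exponent depends on the expression and on `k` but not on `n`, so one word size `O(log n)`
serves the whole family. -/
theorem Expr.eval_lt_and_fits {n k : ℕ} (hn : 1 ≤ n) {s : State} (hs : Bounded ((n + 1) ^ k) s)
    (e : Expr) : e.eval s < (n + 1) ^ e.deg k ∧ ∀ K, e.deg k ≤ K → e.Fits ((n + 1) ^ K) s := by
  have hpow : ∀ {a b : ℕ}, a ≤ b → (n + 1) ^ a ≤ (n + 1) ^ b :=
    fun h => Nat.pow_le_pow_right (by omega) h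
  induction e with
  | lit v =>
    have : v < (n + 1) ^ v := Nat.lt_pow_self (by omega)
    exact ⟨this, fun K hK => lt_of_lt_of_le this (hpow hK)⟩
  | get x => exact ⟨hs.1 x, fun K hK => lt_of_lt_of_le (hs.1 x) (hpow hK)⟩
  | read m e ih =>
    exact ⟨lt_of_lt_of_le (hs.2 _ _) (hpow (le_max_left _ _)), fun K hK =>
      ⟨ih.2 K ((le_max_right _ _).trans hK),
        lt_of_lt_of_le (hs.2 _ _) (hpow ((le_max_left _ _).trans hK))⟩⟩
  | bin o e₁ e₂ ih₁ ih₂ =>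
    have h := Op.apply_lt hn o ih₁.1 ih₂.1
    refine ⟨h, fun K hK => ?_⟩
    simp only [Expr.deg] at hK
    exact ⟨ih₁.2 K (by omega), ih₂.2 K (by omega), lt_of_lt_of_le h (hpow hK)⟩

/-! ### Framing -/

/-- Registers and arrays below `M` hold the same values. -/
def AgreeBelow (M : ℕ) (s s' : State) : Prop :=
  (∀ x < M, s'.reg x = s.reg x) ∧ ∀ m < M, s'.mem m = s.mem m

/-- Registers and arrays from `M` on hold the same values. -/
def AgreeFrom (M : ℕ) (s s' : State) : Prop :=
  (∀ x, M ≤ x → s'.reg x = s.reg x) ∧ ∀ m, M ≤ m → s'.mem m = s.mem m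

theorem AgreeFrom.trans {M : ℕ} {s₁ s₂ s₃ : State} (h : AgreeFrom M s₁ s₂)
    (h' : AgreeFrom M s₂ s₃) : AgreeFrom M s₁ s₃ :=
  ⟨fun x hx => (h'.1 x hx).trans (h.1 x hx), fun m hm => (h'.2 m hm).trans (h.2 m hm)⟩

/-- A strict upper bound for the registers and arrays in an expression. -/
def Expr.names : Expr → ℕ
  | .lit _ => 0
  | .get x => x + 1
  | .read m e => max (m + 1) e.names
  | .bin _ e₁ e₂ => max e₁.names e₂.names

/-- A strict upper bound for the registers and arrays in a program. -/
def Cmd.names : Cmd → ℕ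
  | .skip => 0
  | .assign x e => max (x + 1) e.names
  | .store m i e => max (m + 1) (max i.names e.names)
  | .seq c₁ c₂ => max c₁.names c₂.names
  | .cond e c₁ c₂ => max e.names (max c₁.names c₂.names)
  | .loop e c => max e.names c.names

theorem Expr.eval_congr {M : ℕ} {s s' : State} (h : AgreeBelow M s s') {e : Expr}
    (he : e.names ≤ M) : e.eval s' = e.eval s := by
  induction e with
  | lit v => rfl
  | get x => exact h.1 x he
  | read m e ih =>
    simp only [Expr.names, max_le_iff] at he
    simp only [Expr.eval, ih he.2, h.2 m he.1]
  | bin o e₁ e₂ ih₁ ih₂ =>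
    simp only [Expr.names, max_le_iff] at he
    simp only [Expr.eval, ih₁ he.1, ih₂ he.2]

theorem Expr.Fits.congr {M W : ℕ} {s s' : State} (h : AgreeBelow M s s') {e : Expr}
    (he : e.names ≤ M) (hf : e.Fits W s) : e.Fits W s' := by
  induction e with
  | lit v => exact hf
  | get x => exact (h.1 x he).trans_lt hf
  | read m e ih =>
    simp only [Expr.names, max_le_iff] at he
    refine ⟨ih he.2 hf.1, ?_⟩
    rw [Expr.eval_congr h he.2, h.2 m he.1]
    exact hf.2
  | bin o e₁ e₂ ih₁ ih₂ =>
    simp only [Expr.names, max_le_iff] at he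
    refine ⟨ih₁ he.1 hf.1, ih₂ he.2 hf.2.1, ?_⟩
    rw [Expr.eval_congr h he.1, Expr.eval_congr h he.2]
    exact hf.2.2

/-- A program runs in the same way in the presence of further registers and arrays, which it
leaves alone. -/
theorem Run.frame {M W : ℕ} {c : Cmd} {s s' : State} {t : ℕ} (h : Run W c s s' t) :
    c.names ≤ M → ∀ r, AgreeBelow M s r →
      ∃ r', Run W c r r' t ∧ AgreeBelow M s' r' ∧ AgreeFrom M r r' := by
  induction h with
  | skip s => exact fun _ r hr => ⟨r, .skip r, hr, fun _ _ => rfl, fun _ _ => rfl⟩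
  | assign s x e he =>
    intro hc r hr
    simp only [Cmd.names, max_le_iff] at hc
    refine ⟨_, .assign r x e (he.congr hr hc.2), ⟨fun y hy => ?_, hr.2⟩, fun y hy => ?_,
      fun _ _ => rfl⟩
    · by_cases hyx : y = x
      · subst hyx; simpa using Expr.eval_congr hr hc.2
      · simpa [hyx] using hr.1 y hy
    · have : y ≠ x := by omega
      simp [this]
  | store s m i e hi he =>
    intro hc r hr
    simp only [Cmd.names, max_le_iff] at hc
    refine ⟨_, .store r m i e (hi.congr hr hc.2.1) (he.congr hr hc.2.2), ⟨hr.1, fun y hy => ?_⟩,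
      fun _ _ => rfl, fun y hy => ?_⟩
    · by_cases hyx : y = m
      · subst hyx
        simp [Expr.eval_congr hr hc.2.1, Expr.eval_congr hr hc.2.2, hr.2 y hy]
      · simpa [hyx] using hr.2 y hy
    · have : y ≠ m := by omega
      simp [this]
  | seq _ _ ih₁ ih₂ =>
    intro hc r hr
    simp only [Cmd.names, max_le_iff] at hc
    obtain ⟨r₁, h₁, a₁, b₁⟩ := ih₁ hc.1 r hr
    obtain ⟨r₂, h₂, a₂, b₂⟩ := ih₂ hc.2 r₁ a₁
    exact ⟨r₂, .seq h₁ h₂, a₂, b₁.trans b₂⟩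
  | cond_true he h _ ih =>
    intro hc r hr
    simp only [Cmd.names, max_le_iff] at hc
    obtain ⟨r₁, h₁, a₁, b₁⟩ := ih hc.2.1 r hr
    exact ⟨r₁, .cond_true (he.congr hr hc.1) (by rwa [Expr.eval_congr hr hc.1]) h₁, a₁, b₁⟩
  | cond_false he h _ ih =>
    intro hc r hr
    simp only [Cmd.names, max_le_iff] at hc
    obtain ⟨r₁, h₁, a₁, b₁⟩ := ih hc.2.2 r hr
    exact ⟨r₁, .cond_false (he.congr hr hc.1) (by rwa [Expr.eval_congr hr hc.1]) h₁, a₁, b₁⟩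
  | loop_true he h _ _ ih₁ ih₂ =>
    intro hc r hr
    have hc' := hc
    simp only [Cmd.names, max_le_iff] at hc'
    obtain ⟨r₁, h₁, a₁, b₁⟩ := ih₁ hc'.2 r hr
    obtain ⟨r₂, h₂, a₂, b₂⟩ := ih₂ hc r₁ a₁
    exact ⟨r₂, .loop_true (he.congr hr hc'.1) (by rwa [Expr.eval_congr hr hc'.1]) h₁ h₂, a₂,
      b₁.trans b₂⟩
  | loop_false he h =>
    intro hc r hr
    simp only [Cmd.names, max_le_iff] at hc
    exact ⟨r, .loop_false (he.congr hr hc.1) (by rwa [Expr.eval_congr hr hc.1]), hr,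
      fun _ _ => rfl, fun _ _ => rfl⟩

/-! ### Expressions for sums and for Boolean functions -/

/-- The sum of a finite family of expressions. -/
noncomputable def Expr.sum {ι : Type} [Fintype ι] (e : ι → Expr) : Expr :=
  (Finset.univ.toList.map e).foldr (Expr.bin .add) (.lit 0)

theorem Expr.eval_sum {ι : Type} [Fintype ι] (e : ι → Expr) (s : State) :
    (Expr.sum e).eval s = ∑ i, (e i).eval s := by
  have : ∀ l : List ι, ((l.map e).foldr (Expr.bin .add) (.lit 0)).eval s =
      (l.map fun i => (e i).eval s).sum := by
    intro l
    induction l with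
    | nil => rfl
    | cons a l ih => simp [Expr.eval, Op.apply, ih]
  rw [Expr.sum, this, Finset.sum_map_toList]

/-- Branch on one bit at a time: `e·E₁ + (1 - e)·E₀` selects between the two restrictions of `φ`.
The expression is chosen before the state, so an arbitrary local decoding table costs constant time.
-/
theorem Expr.exists_bool {ι : Type} [Finite ι] (e : ι → Expr)
    (φ : (ι → ZMod 2) → ZMod 2) : ∃ E : Expr, ∀ (s : State) (b : ι → ZMod 2),
      (∀ i, (e i).eval s = (b i).val) → E.eval s = (φ b).val := by
  induction ι using Finite.induction_empty_option with
  | of_equiv f ih =>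
    obtain ⟨E, hE⟩ := ih (e ∘ f) (fun b => φ (b ∘ f.symm))
    refine ⟨E, fun s b hb => ?_⟩
    rw [hE s (b ∘ f) (fun i => hb (f i))]
    congr 2
    ext i
    simp
  | h_empty => exact ⟨.lit (φ isEmptyElim).val, fun s b _ => by
      simp only [Expr.eval]; congr 2; exact Subsingleton.elim _ _⟩
  | h_option ih =>
    have hex : ∀ x : ZMod 2, ∃ E : Expr, ∀ (s : State) (b : _ → ZMod 2),
        (∀ i, (e (some i)).eval s = (b i).val) →
          E.eval s = (φ (fun o => o.elim x b)).val := fun x => ih _ _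
    obtain ⟨E₀, h₀⟩ := hex 0
    obtain ⟨E₁, h₁⟩ := hex 1
    refine ⟨.bin .add (.bin .mul (e none) E₁) (.bin .mul (.bin .sub (.lit 1) (e none)) E₀),
      fun s b hb => ?_⟩
    have hs : ∀ i, (e (some i)).eval s = (b (some i)).val := fun i => hb _
    have hb' : b = fun o => o.elim (b none) (fun i => b (some i)) := by
      ext o; cases o <;> rfl
    have key : ∀ (x : ZMod 2) (ψ : ZMod 2 → ZMod 2),
        x.val * (ψ 1).val + (1 - x.val) * (ψ 0).val = (ψ x).val := by
      intro x ψ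
      rcases (by decide : ∀ x : ZMod 2, x = 0 ∨ x = 1) x with rfl | rfl
      · simp
      · simp [ZMod.val_one]
    simp only [Expr.eval, Op.apply, hb none, h₀ s _ hs, h₁ s _ hs]
    rw [key (b none) (fun x => φ fun o => o.elim x fun i => b (some i)), ← hb']

/-- An expression for a Boolean function of bits that are given by expressions. -/
noncomputable def Expr.bool {ι : Type} [Finite ι] (e : ι → Expr)
    (φ : (ι → ZMod 2) → ZMod 2) : Expr :=
  (Expr.exists_bool e φ).choose

theorem Expr.eval_bool {ι : Type} [Finite ι] (e : ι → Expr) (φ : (ι → ZMod 2) → ZMod 2)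
    {s : State} {b : ι → ZMod 2} (hb : ∀ i, (e i).eval s = (b i).val) :
    (Expr.bool e φ).eval s = (φ b).val :=
  (Expr.exists_bool e φ).choose_spec s b hb

/-! ### Loops that fill an array -/

/-- The states agree but for array `m` and register `r`. -/
def AgreeOff (m r : ℕ) (s s' : State) : Prop :=
  (∀ x, x ≠ r → s'.reg x = s.reg x) ∧ ∀ m', m' ≠ m → s'.mem m' = s.mem m'

theorem AgreeOff.refl (m r : ℕ) (s : State) : AgreeOff m r s s := ⟨fun _ _ => rfl, fun _ _ => rfl⟩

theorem AgreeOff.trans {m r : ℕ} {s₁ s₂ s₃ : State} (h : AgreeOff m r s₁ s₂)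
    (h' : AgreeOff m r s₂ s₃) : AgreeOff m r s₁ s₃ :=
  ⟨fun x hx => (h'.1 x hx).trans (h.1 x hx), fun m hm => (h'.2 m hm).trans (h.2 m hm)⟩

theorem AgreeOff.assign (m r v : ℕ) (s : State) :
    AgreeOff m r s ⟨Function.update s.reg r v, s.mem⟩ :=
  ⟨fun x hx => by simp [hx], fun _ _ => rfl⟩

theorem AgreeOff.store (m r i v : ℕ) (s : State) :
    AgreeOff m r s ⟨s.reg, Function.update s.mem m (Function.update (s.mem m) i v)⟩ :=
  ⟨fun _ _ => rfl, fun m' hm => by simp [hm]⟩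

/-- Stores into array `m`, one for each entry of a list. -/
def storeAll {β : Type} (m : ℕ) (addr val : β → Expr) : List β → Cmd
  | [] => .skip
  | b :: l => .seq (.store m (addr b) (val b)) (storeAll m addr val l)

/-- For each value of register `r` below that of register `q`, store into array `m` the value of
`val b` at the address `addr b`, for all `b`. -/
noncomputable def fill {β : Type} [Fintype β] (q r m : ℕ) (addr val : β → Expr) : Cmd :=
  .seq (.assign r (.lit 0)) (.loop (.bin .lt (.get r) (.get q))
    (.seq (storeAll m addr val Finset.univ.toList) (.assign r (.bin .add (.get r) (.lit 1)))))

/-- The hypothesis `hev` speaks of every state that differs from `s₀` only in array `m` and register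
`r`, so earlier stores cannot disturb later ones. Injectivity of `cell` keeps later stores from
overwriting earlier ones. -/
theorem storeAll_run {β : Type} (m r : ℕ) (addr val : β → Expr) {n k K : ℕ} (hn : 1 ≤ n)
    (hK : ∀ b, (addr b).deg k ≤ K ∧ (val b).deg k ≤ K) {T : ℕ}
    (hT : ∀ b, (addr b).cost + (val b).cost + 1 ≤ T) (s₀ : State) (cell v : β → ℕ)
    (hinj : Function.Injective cell) (hv : ∀ b, v b < (n + 1) ^ k) (i : ℕ)
    (hev : ∀ b s', AgreeOff m r s₀ s' → s'.reg r = i →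
      (addr b).eval s' = cell b ∧ (val b).eval s' = v b) (l : List β) (s : State)
    (hs : Bounded ((n + 1) ^ k) s) (hag : AgreeOff m r s₀ s) (hi : s.reg r = i) :
    ∃ s' t, Run ((n + 1) ^ K) (storeAll m addr val l) s s' t ∧ t ≤ T * l.length + 1 ∧
      Bounded ((n + 1) ^ k) s' ∧ AgreeOff m r s s' ∧ s'.reg r = i ∧
      (∀ b ∈ l, s'.mem m (cell b) = v b) ∧
      ∀ a, (∀ b ∈ l, a ≠ cell b) → s'.mem m a = s.mem m a := by
  induction l generalizing s with
  | nil => exact ⟨s, 1, .skip s, by omega, hs, .refl _ _ _, hi, by simp, by simp⟩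
  | cons b l ih =>
    obtain ⟨ha, hb⟩ := hev b s hag hi
    have hs₁ := hs.store m ((addr b).eval s) (v := (val b).eval s) (hb ▸ hv b)
    have hag₁ := AgreeOff.store m r ((addr b).eval s) ((val b).eval s) s
    obtain ⟨s', t, h₁, h₂, h₃, h₄, h₅, h₆, h₇⟩ := ih _ hs₁ (hag.trans hag₁) hi
    refine ⟨s', _, .seq (.store s m _ _ ((Expr.eval_lt_and_fits hn hs _).2 _ (hK b).1)
      ((Expr.eval_lt_and_fits hn hs _).2 _ (hK b).2)) h₁, ?_, h₃, hag₁.trans h₄, h₅, ?_, ?_⟩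
    · have := hT b
      rw [List.length_cons, Nat.mul_succ]
      omega
    · intro b' hb'
      by_cases hmem : b' ∈ l
      · exact h₆ b' hmem
      · have : b' = b := by simpa [hmem] using hb'
        subst this
        rw [h₇ (cell b') (fun c hc heq => hmem (hinj heq ▸ hc)), ha, hb]
        simp
    · intro a hane
      rw [h₇ a (fun c hc => hane c (List.mem_cons_of_mem _ hc)), ha]
      simp [hane b List.mem_cons_self]

theorem fill_run {β : Type} [Fintype β] (q r m : ℕ) (hqr : q ≠ r) (addr val : β → Expr)
    (k : ℕ) (hk : 1 ≤ k) : ∃ K T : ℕ, ∀ (n : ℕ) (_ : 1 ≤ n) (Γ : Type u) (idx : Γ ≃ Fin n)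
      (s : State) (cell v : Γ × β → ℕ), s.reg q = n → Bounded ((n + 1) ^ k) s →
      Function.Injective cell → (∀ x, v x < (n + 1) ^ k) →
      (∀ g b s', AgreeOff m r s s' → s'.reg r = idx g →
        (addr b).eval s' = cell (g, b) ∧ (val b).eval s' = v (g, b)) →
      ∀ K', K ≤ K' → ∃ s' t, Run ((n + 1) ^ K') (fill q r m addr val) s s' t ∧ t ≤ T * n ∧
        Bounded ((n + 1) ^ k) s' ∧ AgreeOff m r s s' ∧ (∀ x, s'.mem m (cell x) = v x) ∧
        ∀ a, (∀ x, a ≠ cell x) → s'.mem m a = s.mem m a := by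
  set L := (Finset.univ : Finset β).toList with hL
  set K₀ := ∑ b, ((addr b).deg k + (val b).deg k)
  set T₀ := ∑ b, ((addr b).cost + (val b).cost + 1)
  have hK₀ : ∀ b, (addr b).deg k + (val b).deg k ≤ K₀ := fun b =>
    Finset.single_le_sum (f := fun b => (addr b).deg k + (val b).deg k) (fun _ _ => Nat.zero_le _)
      (Finset.mem_univ b)
  have hT₀ : ∀ b, (addr b).cost + (val b).cost + 1 ≤ T₀ := fun b =>
    Finset.single_le_sum (f := fun b => (addr b).cost + (val b).cost + 1)
      (fun _ _ => Nat.zero_le _) (Finset.mem_univ b)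
  -- The loop test has exponent `2k + 1` and the increment `k + 2`. The summand `20` absorbs the
  -- constant cost of each round, the initialisation and the last test; the latter two are charged
  -- to a round, which exists because `n ≥ 1`.
  refine ⟨K₀ + 2 * k + 3, T₀ * L.length + 20, ?_⟩
  intro n hn Γ idx s cell v hq hs hinj hv hev K hK
  have hnk : n < (n + 1) ^ k := lt_of_lt_of_le (by simp) (Nat.pow_le_pow_right (by omega) hk)
  have hfits : ∀ {s' : State} (_ : Bounded ((n + 1) ^ k) s') (e : Expr), e.deg k ≤ K →
      e.Fits ((n + 1) ^ K) s' := fun h e he => (Expr.eval_lt_and_fits hn h e).2 K he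
  -- Induction on the number `d` of remaining rounds. The invariant is that the cells of all group
  -- elements numbered below `i` are filled and no foreign cell has changed.
  have key : ∀ (d i : ℕ) (s₁ : State), i + d = n → Bounded ((n + 1) ^ k) s₁ →
      AgreeOff m r s s₁ → s₁.reg r = i →
      (∀ g b, (idx g : ℕ) < i → s₁.mem m (cell (g, b)) = v (g, b)) →
      (∀ a, (∀ x, a ≠ cell x) → s₁.mem m a = s.mem m a) →
      ∃ s' t, Run ((n + 1) ^ K) (.loop (.bin .lt (.get r) (.get q))
          (.seq (storeAll m addr val L) (.assign r (.bin .add (.get r) (.lit 1))))) s₁ s' t ∧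
        t ≤ (T₀ * L.length + 10) * d + 4 ∧
        Bounded ((n + 1) ^ k) s' ∧ AgreeOff m r s s' ∧ (∀ x, s'.mem m (cell x) = v x) ∧
        ∀ a, (∀ x, a ≠ cell x) → s'.mem m a = s.mem m a := by
    intro d
    induction d with
    | zero =>
      intro i s₁ hid hs₁ hag hi hc hu
      refine ⟨s₁, _, .loop_false (hfits hs₁ _ ?_) ?_, ?_, hs₁, hag, ?_, hu⟩
      · simp only [Expr.deg]; omega
      · simp only [Expr.eval, Op.apply, hi, hag.1 q hqr, hq]
        rw [if_neg (by omega)]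
      · simp only [Expr.cost]; omega
      · rintro ⟨g, b⟩
        exact hc g b (by have := (idx g).2; omega)
    | succ d ih =>
      intro i s₁ hid hs₁ hag hi hc hu
      have hin : i < n := by omega
      set g₀ := idx.symm ⟨i, hin⟩ with hg₀
      have hidx : (idx g₀ : ℕ) = i := by simp [hg₀]
      obtain ⟨s₂, t₂, h₁, h₂, h₃, h₄, h₅, h₆, h₇⟩ := storeAll_run m r addr val hn (K := K)
        (fun b => by have := hK₀ b; omega) hT₀ s (fun b => cell (g₀, b)) (fun b => v (g₀, b))
        (fun b b' h => by simpa using hinj h) (fun b => hv _) i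
        (fun b s' h h' => hev g₀ b s' h (by rw [h', hidx])) L s₁ hs₁ hag hi
      have hlt : (Expr.bin .add (.get r) (.lit 1)).eval s₂ = i + 1 := by
        simp [Expr.eval, Op.apply, h₅]
      have hbd₃ := h₃.assign r (v := (Expr.bin .add (.get r) (.lit 1)).eval s₂) (by omega)
      have hag₃ := AgreeOff.assign m r ((Expr.bin .add (.get r) (.lit 1)).eval s₂) s₂
      obtain ⟨s', t, k₁, k₂, k₃⟩ := ih (i + 1) _ (by omega) hbd₃
        ((hag.trans h₄).trans hag₃) (by simp [hlt])
        (by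
          intro g b hg
          by_cases hgi : (idx g : ℕ) = i
          · have : g = g₀ := by rw [hg₀, Equiv.eq_symm_apply]; exact Fin.ext hgi
            subst this
            exact h₆ b (by simp [hL])
          · change s₂.mem m _ = _
            rw [h₇ _ (fun b' _ heq => hgi (by
              have := congrArg Prod.fst (hinj heq)
              simp only at this
              rw [this, hidx]))]
            exact hc g b (by omega))
        (by
          intro a ha
          change s₂.mem m _ = _
          rw [h₇ a (fun b _ => ha _)]
          exact hu a ha)
      refine ⟨s', _, .loop_true (hfits hs₁ _ ?_) ?_ (.seq h₁ (.assign s₂ r _ (hfits h₃ _ ?_))) k₁,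
        ?_, k₃⟩
      · simp only [Expr.deg]; omega
      · simp only [Expr.eval, Op.apply, hi, hag.1 q hqr, hq]
        rw [if_pos hin]
        exact one_ne_zero
      · simp only [Expr.deg]; omega
      · simp only [Expr.cost]
        rw [Nat.mul_succ]
        omega
  have hag₀ := AgreeOff.assign m r 0 s
  obtain ⟨s', t, h₁, h₂, h₃⟩ := key n 0 ⟨Function.update s.reg r 0, s.mem⟩ (by omega)
    (hs.assign r (by positivity)) hag₀ (by simp) (by simp) (fun _ _ => rfl)
  refine ⟨s', _, .seq (.assign s r (.lit 0) (hfits hs _ (by simp [Expr.deg]))) h₁, ?_, h₃⟩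
  simp only [Expr.cost]
  nlinarith

/-! ### Linear-time realization of state transitions -/

/-- The program `c` leads, on words of `O(log N)` bits and in time `O(N)`, from states with `pre`
to states with `post`, uniformly over a family of parameters. -/
def Realizes {J : Type*} (N : J → ℕ) (c : Cmd) (pre post : J → State → Prop) : Prop :=
  ∃ K T : ℕ, ∀ j s, pre j s → ∀ K', K ≤ K' →
    ∃ s' t, Run ((N j + 1) ^ K') c s s' t ∧ t ≤ T * N j ∧ post j s'

/-- Both parts must run on words of the same length; since `Realizes` allows every larger exponent,
the maximum works. -/
theorem Realizes.seq {J : Type*} {N : J → ℕ} {c₁ c₂ : Cmd} {p₁ p₂ p₃ : J → State → Prop}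
    (h₁ : Realizes N c₁ p₁ p₂) (h₂ : Realizes N c₂ p₂ p₃) : Realizes N (.seq c₁ c₂) p₁ p₃ := by
  obtain ⟨K₁, T₁, h₁⟩ := h₁
  obtain ⟨K₂, T₂, h₂⟩ := h₂
  refine ⟨max K₁ K₂, T₁ + T₂, fun j s hs K hK => ?_⟩
  obtain ⟨s₁, t₁, a₁, b₁, q₁⟩ := h₁ j s hs K ((le_max_left _ _).trans hK)
  obtain ⟨s₂, t₂, a₂, b₂, q₂⟩ := h₂ j s₁ q₁ K ((le_max_right _ _).trans hK)
  exact ⟨s₂, _, .seq a₁ a₂, by rw [add_mul]; omega, q₂⟩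

theorem Realizes.fill {J : Type*} {N : J → ℕ} (hN : ∀ j, 1 ≤ N j) {Γ : J → Type u}
    (idx : ∀ j, Γ j ≃ Fin (N j)) {β : Type} [Fintype β] {q r m : ℕ} (hqr : q ≠ r)
    (addr val : β → Expr) {k : ℕ} (hk : 1 ≤ k) (cell v : ∀ j, Γ j × β → ℕ)
    (hinj : ∀ j, Function.Injective (cell j)) (hv : ∀ j x, v j x < (N j + 1) ^ k)
    {pre post : J → State → Prop}
    (hpre : ∀ j s, pre j s → s.reg q = N j ∧ Bounded ((N j + 1) ^ k) s ∧
      ∀ g b s', AgreeOff m r s s' → s'.reg r = idx j g →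
        (addr b).eval s' = cell j (g, b) ∧ (val b).eval s' = v j (g, b))
    (hpost : ∀ j s s', pre j s → Bounded ((N j + 1) ^ k) s' → AgreeOff m r s s' →
      (∀ x, s'.mem m (cell j x) = v j x) →
      (∀ a, (∀ x, a ≠ cell j x) → s'.mem m a = s.mem m a) → post j s') :
    Realizes N (fill q r m addr val) pre post := by
  obtain ⟨K, T, h⟩ := fill_run.{u} q r m hqr addr val k hk
  refine ⟨K, T, fun j s hs K' hK => ?_⟩
  obtain ⟨hq, hb, he⟩ := hpre j s hs
  obtain ⟨s', t, h₁, h₂, h₃, h₄, h₅, h₆⟩ := h (N j) (hN j) (Γ j) (idx j) s (cell j) (v j) hq hb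
    (hinj j) (hv j) he K' hK
  exact ⟨s', t, h₁, h₂, hpost j s s' hs h₃ h₄ h₅ h₆⟩

end RAM

/-! ### Parity-check matrices and local decoding -/

section LocalCodes

open Matrix

/-- Independent rows make `Hᵀ` injective; transpose a left inverse of it. -/
theorem IsParityCheck.exists_right_inverse {m n : ℕ} {H : Matrix (Fin m) (Fin n) (ZMod 2)}
    {C : Submodule (ZMod 2) (Fin n → ZMod 2)} (h : IsParityCheck H C) :
    ∃ R : Matrix (Fin n) (Fin m) (ZMod 2), H * R = 1 := by
  have hinj : LinearMap.ker (Matrix.mulVecLin Hᵀ) = ⊥ := by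
    rw [LinearMap.ker_eq_bot]
    have := Matrix.vecMul_injective_iff.2 h.2
    simpa [Function.Injective, Matrix.mulVec_transpose] using this
  obtain ⟨g, hg⟩ := LinearMap.exists_leftInverse_of_injective _ hinj
  refine ⟨(LinearMap.toMatrix' g)ᵀ, ?_⟩
  have h1 : LinearMap.toMatrix' (g ∘ₗ Matrix.mulVecLin Hᵀ) = 1 := by
    rw [hg, LinearMap.toMatrix'_id]
  rw [LinearMap.toMatrix'_comp, ← Matrix.toLin'_apply', LinearMap.toMatrix'_toLin'] at h1
  rw [← Matrix.transpose_transpose H, ← Matrix.transpose_mul, h1,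
    Matrix.transpose_one]

/-- The rows of `H` are orthogonal to `C`, so they lie in the kernel of `H'`. -/
theorem IsParityCheck.mul_transpose_dual {m k n : ℕ} {H : Matrix (Fin m) (Fin n) (ZMod 2)}
    {H' : Matrix (Fin k) (Fin n) (ZMod 2)} {C : Submodule (ZMod 2) (Fin n → ZMod 2)}
    (h : IsParityCheck H C) (h' : IsParityCheck H' (dualCode C)) : H * H'ᵀ = 0 := by
  have hrow : ∀ i, H'.mulVec (H i) = 0 := by
    intro i
    rw [← h'.1]
    intro y hy
    exact congrFun ((h.1 y).1 hy) i
  ext i j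
  have := congrFun (hrow i) j
  rw [Matrix.mulVec, dotProduct_comm] at this
  simpa [Matrix.mul_apply, dotProduct] using this

/-- The rows of a parity-check matrix of the dual code generate the code, and the coefficients
are given by a matrix. -/
theorem IsParityCheck.exists_encoder_inverse {k n : ℕ} {H' : Matrix (Fin k) (Fin n) (ZMod 2)}
    {C : Submodule (ZMod 2) (Fin n → ZMod 2)} (h' : IsParityCheck H' (dualCode C)) :
    ∃ S : Matrix (Fin k) (Fin n) (ZMod 2), ∀ x ∈ C, H'ᵀ.mulVec (S.mulVec x) = x := by
  obtain ⟨R, hR⟩ := h'.exists_right_inverse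
  refine ⟨Rᵀ, fun x hx => ?_⟩
  apply dotProduct_eq
  intro y
  -- This vector is in `ker H' = C^⊥`, so `x` pairs equally with `y` and with `R H' y`. No appeal to
  -- `C^⊥⊥ = C` is necessary.
  have hy : y - R.mulVec (H'.mulVec y) ∈ dualCode C := by
    rw [h'.1, Matrix.mulVec_sub, Matrix.mulVec_mulVec, Matrix.mulVec_mulVec, hR]
    simp
  have h2 := hy x hx
  rw [sub_dotProduct, sub_eq_zero] at h2
  rw [dotProduct_comm x y, h2, Matrix.mulVec_transpose, Matrix.mulVec_transpose,
    ← Matrix.dotProduct_mulVec, ← Matrix.dotProduct_mulVec, dotProduct_comm]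

/-- Split `f` with the idempotent `HBᵀ * Rᵀ`: the part `f * HBᵀ * Rᵀ` has columns killed by `HA`,
and the remainder has rows killed by `HB`. -/
theorem mem_tensorSum_of_mul_eq_zero {na nb ma mb : ℕ} {HA : Matrix (Fin ma) (Fin na) (ZMod 2)}
    {HB : Matrix (Fin mb) (Fin nb) (ZMod 2)} {CA : Submodule (ZMod 2) (Fin na → ZMod 2)}
    {CB : Submodule (ZMod 2) (Fin nb → ZMod 2)} (hA : IsParityCheck HA CA)
    (hB : IsParityCheck HB CB) {f : Matrix (Fin na) (Fin nb) (ZMod 2)} (hf : HA * f * HBᵀ = 0) :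
    f ∈ tensorSum CA CB := by
  obtain ⟨R, hR⟩ := hB.exists_right_inverse
  have hR' : Rᵀ * HBᵀ = 1 := by rw [← Matrix.transpose_mul, hR, Matrix.transpose_one]
  refine Submodule.mem_sup.2 ⟨f * HBᵀ * Rᵀ, ⟨fun j => ?_, fun _ => trivial⟩,
    f - f * HBᵀ * Rᵀ, ⟨fun _ => trivial, fun i => ?_⟩, by abel⟩
  · rw [hA.1]
    have : HA * (f * HBᵀ * Rᵀ) = 0 := by
      rw [← Matrix.mul_assoc, ← Matrix.mul_assoc, hf, Matrix.zero_mul]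
    ext p
    exact congrFun (congrFun this p) j
  · rw [hB.1]
    have : (f - f * HBᵀ * Rᵀ) * HBᵀ = 0 := by
      rw [Matrix.sub_mul, Matrix.mul_assoc (f * HBᵀ), hR', Matrix.mul_one, sub_self]
    ext q
    have h1 := congrFun (congrFun this i) q
    rw [Matrix.mulVec, dotProduct_comm]
    exact h1

theorem entryWeight_add_le {na nb : ℕ} (c c' : Matrix (Fin na) (Fin nb) (ZMod 2)) :
    entryWeight (c + c') ≤ entryWeight c + entryWeight c' := by
  refine (Set.ncard_le_ncard (t := {p | c p.1 p.2 ≠ 0} ∪ {p | c' p.1 p.2 ≠ 0}) ?_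
    (Set.toFinite _)).trans (Set.ncard_union_le _ _)
  intro p hp
  by_contra h
  simp only [Set.mem_union, Set.mem_ofPred_eq, not_or, not_not] at h
  exact hp (by simp [h.1, h.2])

/-- Lifting creates no new non-zero column or row, and each has `n` entries. -/
theorem entryWeight_lift_le {n ma mb : ℕ} (RA : Matrix (Fin n) (Fin ma) (ZMod 2))
    (RB : Matrix (Fin n) (Fin mb) (ZMod 2)) (x : Matrix (Fin ma) (Fin n) (ZMod 2))
    (y : Matrix (Fin n) (Fin mb) (ZMod 2)) :
    entryWeight (RA * x + y * RBᵀ) ≤ n * (colWeight x + rowWeight y) := by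
  refine (Set.ncard_le_ncard (t := (Set.univ ×ˢ {t | ∃ p, x p t ≠ 0}) ∪
    ({s | ∃ q, y s q ≠ 0} ×ˢ Set.univ)) ?_ (Set.toFinite _)).trans
      ((Set.ncard_union_le _ _).trans ?_)
  · rintro ⟨s, t⟩ hp
    by_contra h
    simp only [Set.mem_union, Set.mem_prod, Set.mem_univ, Set.mem_ofPred_eq, true_and, and_true,
      not_or, not_exists, not_not] at h
    apply hp
    simp [Matrix.mul_apply, h.1, h.2]
  · rw [Set.ncard_prod, Set.ncard_prod, Set.ncard_univ, Nat.card_fin]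
    apply le_of_eq
    simp only [colWeight, rowWeight]
    ring

/-- A local decoder: from the syndrome of values `x`, `y` on the edges at a vertex it finds the
sum of lifts of `x` and `y` up to local codewords of bounded weight. -/
theorem exists_local_decoder {n ma mb : ℕ} {CA CB : Submodule (ZMod 2) (Fin n → ZMod 2)}
    {HA : Matrix (Fin ma) (Fin n) (ZMod 2)} {HB : Matrix (Fin mb) (Fin n) (ZMod 2)}
    (hA : IsParityCheck HA CA) (hB : IsParityCheck HB CB) {d₂ : ℝ} (hrob : IsRobust CA CB d₂)
    {RA : Matrix (Fin n) (Fin ma) (ZMod 2)} (hRA : HA * RA = 1)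
    {RB : Matrix (Fin n) (Fin mb) (ZMod 2)} (hRB : HB * RB = 1) :
    ∃ D : Matrix (Fin ma) (Fin mb) (ZMod 2) → Matrix (Fin n) (Fin n) (ZMod 2),
      ∀ (x : Matrix (Fin ma) (Fin n) (ZMod 2)) (y : Matrix (Fin n) (Fin mb) (ZMod 2)),
        ∃ ca ∈ tensorCode CA (⊤ : Submodule (ZMod 2) (Fin n → ZMod 2)),
          ∃ cb ∈ tensorCode (⊤ : Submodule (ZMod 2) (Fin n → ZMod 2)) CB,
            D (x * HBᵀ + HA * y) = RA * x + y * RBᵀ + ca + cb ∧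
            d₂ * ((colWeight ca : ℝ) + (rowWeight cb : ℝ)) ≤
              2 * n * ((colWeight x : ℝ) + (rowWeight y : ℝ)) := by
  have hRB' : RBᵀ * HBᵀ = 1 := by rw [← Matrix.transpose_mul, hRB, Matrix.transpose_one]
  have hsyn : ∀ (x : Matrix (Fin ma) (Fin n) (ZMod 2)) (y : Matrix (Fin n) (Fin mb) (ZMod 2)),
      HA * (RA * x + y * RBᵀ) * HBᵀ = x * HBᵀ + HA * y := by
    intro x y
    rw [Matrix.mul_add, Matrix.add_mul, ← Matrix.mul_assoc, hRA, Matrix.one_mul,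
      ← Matrix.mul_assoc, Matrix.mul_assoc _ RBᵀ, hRB', Matrix.mul_one]
  have hmin : ∀ σ : Matrix (Fin ma) (Fin mb) (ZMod 2), ∃ f : Matrix (Fin n) (Fin n) (ZMod 2),
      HA * f * HBᵀ = σ ∧ ∀ f' : Matrix (Fin n) (Fin n) (ZMod 2), HA * f' * HBᵀ = σ →
        entryWeight f ≤ entryWeight f' := by
    intro σ
    have hne : {f : Matrix (Fin n) (Fin n) (ZMod 2) | HA * f * HBᵀ = σ}.Nonempty :=
      ⟨_, by
        have := hsyn (σ * RBᵀ) (0 : Matrix (Fin n) (Fin mb) (ZMod 2))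
        rwa [Matrix.mul_assoc σ, hRB', Matrix.mul_one, Matrix.mul_zero, add_zero] at this⟩
    obtain ⟨f, hf, hmin⟩ := (measure entryWeight).wf.has_min _ hne
    exact ⟨f, hf, fun f' hf' => not_lt.1 (hmin f' hf')⟩
  choose D hD hDmin using hmin
  refine ⟨D, fun x y => ?_⟩
  set L := RA * x + y * RBᵀ with hL
  have hmem : D (x * HBᵀ + HA * y) + L ∈ tensorSum CA CB := by
    apply mem_tensorSum_of_mul_eq_zero hA hB
    rw [Matrix.mul_add, Matrix.add_mul, hD, hsyn]
    ext p q
    exact CharTwo.add_self_eq_zero (R := ZMod 2) _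
  obtain ⟨ca, hca, cb, hcb, heq, hw⟩ := hrob _ hmem
  refine ⟨ca, hca, cb, hcb, ?_, hw.trans ?_⟩
  · rw [add_assoc, ← heq, add_comm _ L, ← add_assoc]
    ext s t
    simp [CharTwo.add_self_eq_zero]
  -- The lift `L` competes in the minimisation that defines `D`, so the difference weighs at most
  -- `2|L|`.
  · have h1 := entryWeight_add_le (D (x * HBᵀ + HA * y)) L
    have h2 := hDmin _ L (hsyn x y)
    have h3 := entryWeight_lift_le RA RB x y
    rw [← hL] at h3
    have : entryWeight (D (x * HBᵀ + HA * y) + L) ≤ 2 * n * (colWeight x + rowWeight y) := by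
      rw [mul_assoc]; omega
    exact_mod_cast this

end LocalCodes

/-! ### The chain complex: explicit formulas and the decoded chain -/

namespace LRCayley

open Matrix

variable {Δ : ℕ} (X : LRCayley.{u} Δ) {ma mb ka kb : ℕ}

/-- The generator `a_s`, or `1`. -/
def stepA (k : Bool) (s : Fin Δ) : X.G := if k then X.a s else 1

/-- The generator `b_t`, or `1`. -/
def stepB (l : Bool) (t : Fin Δ) : X.G := if l then X.b t else 1

theorem hSide_eq (k : Bool) (f : X.Face) : X.hSide k f = (k, X.stepA k f.2.1 * f.1, f.2.2) := by
  cases k <;> simp [hSide, stepA]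

theorem vSide_eq (l : Bool) (f : X.Face) : X.vSide l f = (l, f.1 * X.stepB l f.2.2, f.2.1) := by
  cases l <;> simp [vSide, stepB]

theorem hEnd_eq (l : Bool) (e : X.HEdge) : X.hEnd l e = (e.1, l, e.2.1 * X.stepB l e.2.2) := by
  cases l <;> simp [hEnd, stepB]

theorem vEnd_eq (k : Bool) (e : X.VEdge) : X.vEnd k e = (k, e.1, X.stepA k e.2.2 * e.2.1) := by
  cases k <;> simp [vEnd, stepA]

open Classical in
-- The type `k` belongs to the edge, so the two sides of a face never coincide and the `∃ k` in
-- `bdry2` loses no multiplicity. Each label `s` gives exactly one face on the edge.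
theorem bdry2_mulVec_inl (HA : Matrix (Fin ma) (Fin Δ) (ZMod 2))
    (HB : Matrix (Fin mb) (Fin Δ) (ZMod 2)) (z : X.Face → ZMod 2) (k : Bool) (h : X.G)
    (t : Fin Δ) (p : Fin ma) :
    (X.bdry2 HA HB).mulVec z (Sum.inl ((k, h, t), p)) =
      ∑ s, HA p s * z ((X.stepA k s)⁻¹ * h, s, t) := by
  have hcond : ∀ (g : X.G) (s t' : Fin Δ), (∃ k', X.hSide k' (g, s, t') = (k, h, t)) ↔
      (g = (X.stepA k s)⁻¹ * h ∧ t' = t) := by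
    intro g s t'
    simp only [hSide_eq, Prod.mk.injEq, exists_eq_left, eq_inv_mul_iff_mul_eq]
  simp only [Matrix.mulVec, dotProduct, bdry2, Matrix.of_apply, hcond, Fintype.sum_prod_type,
    ite_mul, zero_mul]
  rw [Finset.sum_comm]
  refine Finset.sum_congr rfl fun s _ => ?_
  rw [Finset.sum_comm]
  simp [ite_and]

open Classical in
theorem bdry2_mulVec_inr (HA : Matrix (Fin ma) (Fin Δ) (ZMod 2))
    (HB : Matrix (Fin mb) (Fin Δ) (ZMod 2)) (z : X.Face → ZMod 2) (l : Bool) (h : X.G)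
    (s : Fin Δ) (q : Fin mb) :
    (X.bdry2 HA HB).mulVec z (Sum.inr ((l, h, s), q)) =
      ∑ t, HB q t * z (h * (X.stepB l t)⁻¹, s, t) := by
  have hcond : ∀ (g : X.G) (s' t : Fin Δ), (∃ l', X.vSide l' (g, s', t) = (l, h, s)) ↔
      (g = h * (X.stepB l t)⁻¹ ∧ s' = s) := by
    intro g s' t
    simp only [vSide_eq, Prod.mk.injEq, exists_eq_left, eq_mul_inv_iff_mul_eq]
  simp only [Matrix.mulVec, dotProduct, bdry2, Matrix.of_apply, hcond, Fintype.sum_prod_type,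
    ite_mul, zero_mul]
  rw [Finset.sum_comm, Finset.sum_eq_single s]
  · rw [Finset.sum_comm]
    simp
  · intro s' _ hs'
    simp [hs']
  · simp

open Classical in
theorem bdry1_mulVec (HA : Matrix (Fin ma) (Fin Δ) (ZMod 2))
    (HB : Matrix (Fin mb) (Fin Δ) (ZMod 2)) (c : X.EdgeBit ma mb → ZMod 2) (k l : Bool)
    (h : X.G) (p : Fin ma) (q : Fin mb) :
    (X.bdry1 HA HB).mulVec c ((k, l, h), p, q) =
      ∑ t, c (Sum.inl ((k, h * (X.stepB l t)⁻¹, t), p)) * HB q t +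
        ∑ s, HA p s * c (Sum.inr ((l, (X.stepA k s)⁻¹ * h, s), q)) := by
  have hcond : ∀ (k' : Bool) (g : X.G) (t : Fin Δ), (∃ l', X.hEnd l' (k', g, t) = (k, l, h)) ↔
      (k' = k ∧ g = h * (X.stepB l t)⁻¹) := by
    intro k' g t
    simp only [hEnd_eq, Prod.mk.injEq, eq_mul_inv_iff_mul_eq]
    constructor
    · rintro ⟨l', h1, rfl, h2⟩; exact ⟨h1, h2⟩
    · rintro ⟨h1, h2⟩; exact ⟨l, h1, rfl, h2⟩
  have vcond : ∀ (l' : Bool) (g : X.G) (s : Fin Δ), (∃ k', X.vEnd k' (l', g, s) = (k, l, h)) ↔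
      (l' = l ∧ g = (X.stepA k s)⁻¹ * h) := by
    intro l' g s
    simp only [vEnd_eq, Prod.mk.injEq, eq_inv_mul_iff_mul_eq, exists_eq_left]
  simp only [Matrix.mulVec, dotProduct, bdry1, Matrix.of_apply, Fintype.sum_sum_type, hcond, vcond,
    Fintype.sum_prod_type, ite_mul, zero_mul]
  congr 1
  · rw [Finset.sum_eq_single k]
    · rw [Finset.sum_comm]
      refine Finset.sum_congr rfl fun t _ => ?_
      simp [ite_and, mul_comm]
    · intro k' _ hk'
      simp [hk']
    · simp
  · rw [Finset.sum_eq_single l]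
    · rw [Finset.sum_comm]
      refine Finset.sum_congr rfl fun t _ => ?_
      simp [ite_and]
    · intro k' _ hk'
      simp [hk']
    · simp

open Classical in
theorem bdry2_transpose_mulVec (HA : Matrix (Fin ma) (Fin Δ) (ZMod 2))
    (HB : Matrix (Fin mb) (Fin Δ) (ZMod 2)) (c : X.EdgeBit ma mb → ZMod 2) (g : X.G)
    (s t : Fin Δ) :
    (X.bdry2 HA HB).transpose.mulVec c (g, s, t) =
      ∑ k, ∑ p, HA p s * c (Sum.inl ((k, X.stepA k s * g, t), p)) +
        ∑ l, ∑ q, HB q t * c (Sum.inr ((l, g * X.stepB l t, s), q)) := by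
  simp only [Matrix.mulVec, dotProduct, Matrix.transpose_apply, bdry2, Matrix.of_apply,
    Fintype.sum_sum_type, Fintype.sum_prod_type, ite_mul, zero_mul, hSide_eq, vSide_eq,
    Prod.mk.injEq, exists_eq_left]
  congr 1
  · refine Finset.sum_congr rfl fun k _ => ?_
    simp [ite_and, Finset.sum_ite_irrel]
  · refine Finset.sum_congr rfl fun k _ => ?_
    simp [ite_and, Finset.sum_ite_irrel]

open Classical in
theorem bdry1_transpose_mulVec_inl (HA : Matrix (Fin ma) (Fin Δ) (ZMod 2))
    (HB : Matrix (Fin mb) (Fin Δ) (ZMod 2)) (z : X.VertexBit ma mb → ZMod 2) (k : Bool) (g : X.G)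
    (t : Fin Δ) (p : Fin ma) :
    (X.bdry1 HA HB).transpose.mulVec z (Sum.inl ((k, g, t), p)) =
      ∑ l, ∑ q, HB q t * z ((k, l, g * X.stepB l t), p, q) := by
  have hcond : ∀ (k' l : Bool) (h : X.G), (∃ l', X.hEnd l' (k, g, t) = (k', l, h)) ↔
      (k = k' ∧ g * X.stepB l t = h) := by
    intro k' l h
    simp only [hEnd_eq, Prod.mk.injEq]
    constructor
    · rintro ⟨l', h1, rfl, h2⟩; exact ⟨h1, h2⟩
    · rintro ⟨h1, h2⟩; exact ⟨l, h1, rfl, h2⟩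
  simp only [Matrix.mulVec, dotProduct, Matrix.transpose_apply, bdry1, Matrix.of_apply,
    Fintype.sum_prod_type, ite_mul, zero_mul, hcond]
  simp [ite_and, Finset.sum_ite_irrel]

open Classical in
theorem bdry1_transpose_mulVec_inr (HA : Matrix (Fin ma) (Fin Δ) (ZMod 2))
    (HB : Matrix (Fin mb) (Fin Δ) (ZMod 2)) (z : X.VertexBit ma mb → ZMod 2) (l : Bool) (g : X.G)
    (s : Fin Δ) (q : Fin mb) :
    (X.bdry1 HA HB).transpose.mulVec z (Sum.inr ((l, g, s), q)) =
      ∑ k, ∑ p, HA p s * z ((k, l, X.stepA k s * g), p, q) := by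
  have hcond : ∀ (k l' : Bool) (h : X.G), (∃ k', X.vEnd k' (l, g, s) = (k, l', h)) ↔
      (l = l' ∧ X.stepA k s * g = h) := by
    intro k l' h
    simp only [vEnd_eq, Prod.mk.injEq, exists_eq_left]
  simp only [Matrix.mulVec, dotProduct, Matrix.transpose_apply, bdry1, Matrix.of_apply,
    Fintype.sum_prod_type, ite_mul, zero_mul, hcond]
  refine Finset.sum_congr rfl fun k _ => ?_
  simp [ite_and, Finset.sum_ite_irrel]

end LRCayley

namespace LRCayley

open Matrix

variable {Δ : ℕ} (X : LRCayley.{u} Δ) {ma mb ka kb : ℕ}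

/-! ### Counting edges -/

/-- Right translation by `stepB l t` is a bijection of `G`: every vertex is an end of exactly one
horizontal edge with a given label. -/
theorem sum_hEdge_ends (F : X.Vertex → Fin Δ → ℕ) :
    ∑ e : X.HEdge, ∑ l, F (e.1, l, e.2.1 * X.stepB l e.2.2) e.2.2 = ∑ v, ∑ t, F v t := by
  simp only [Fintype.sum_prod_type]
  refine Finset.sum_congr rfl fun k _ => ?_
  rw [Finset.sum_congr rfl fun g _ => Finset.sum_comm, Finset.sum_comm]
  refine Finset.sum_congr rfl fun l _ => ?_
  rw [Finset.sum_comm, Finset.sum_comm (s := (Finset.univ : Finset X.G))]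
  refine Finset.sum_congr rfl fun t _ => ?_
  exact Equiv.sum_comp (Equiv.mulRight (X.stepB l t)) fun h => F (k, l, h) t

theorem sum_vEdge_ends (F : X.Vertex → Fin Δ → ℕ) :
    ∑ e : X.VEdge, ∑ k, F (k, e.1, X.stepA k e.2.2 * e.2.1) e.2.2 = ∑ v, ∑ s, F v s := by
  simp only [Fintype.sum_prod_type]
  rw [Finset.sum_congr rfl fun l _ => Finset.sum_congr rfl fun g _ => Finset.sum_comm,
    Finset.sum_congr rfl fun l _ => Finset.sum_comm, Finset.sum_comm]
  refine Finset.sum_congr rfl fun k _ => Finset.sum_congr rfl fun l _ => ?_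
  rw [Finset.sum_comm, Finset.sum_comm (s := (Finset.univ : Finset X.G))]
  refine Finset.sum_congr rfl fun s _ => ?_
  exact Equiv.sum_comp (Equiv.mulLeft (X.stepA k s)) fun h => F (k, l, h) s

open Classical in
/-- `1` if the proposition holds, `0` otherwise. -/
noncomputable def truthValue (P : Prop) : ℕ := if P then 1 else 0

theorem ncard_eq_sum_truthValue {α : Type*} [Fintype α] (P : α → Prop) :
    Set.ncard {x | P x} = ∑ x, truthValue (P x) := by
  classical
  rw [Set.ncard_eq_toFinset_card']
  simp [truthValue]

/-- Values on the horizontal edges at a vertex, as a matrix. -/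
def hView (c : X.EdgeBit ma mb → ZMod 2) (v : X.Vertex) : Matrix (Fin ma) (Fin Δ) (ZMod 2) :=
  Matrix.of fun p t => c (Sum.inl ((v.1, v.2.2 * (X.stepB v.2.1 t)⁻¹, t), p))

/-- Values on the vertical edges at a vertex, as a matrix. -/
def vView (c : X.EdgeBit ma mb → ZMod 2) (v : X.Vertex) : Matrix (Fin Δ) (Fin mb) (ZMod 2) :=
  Matrix.of fun s q => c (Sum.inr ((v.2.1, (X.stepA v.1 s)⁻¹ * v.2.2, s), q))

/-- Every edge is seen, with the same value, from both of its ends. -/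
theorem sum_view_weight (c : X.EdgeBit ma mb → ZMod 2) :
    ∑ v, (colWeight (X.hView c v) + rowWeight (X.vView c v)) = 2 * X.edgeWeight c := by
  classical
  rw [Finset.sum_add_distrib, edgeWeight, mul_add]
  congr 1
  · simp only [colWeight, ncard_eq_sum_truthValue]
    rw [← sum_hEdge_ends X (fun v t => truthValue (∃ p, X.hView c v p t ≠ 0)), Finset.mul_sum]
    refine Finset.sum_congr rfl fun e _ => ?_
    simp [hView, two_mul]
  · simp only [rowWeight, ncard_eq_sum_truthValue]
    rw [← sum_vEdge_ends X (fun v s => truthValue (∃ q, X.vView c v s q ≠ 0)), Finset.mul_sum]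
    refine Finset.sum_congr rfl fun e _ => ?_
    simp [vView, two_mul]

/-- Charge each edge in the support of `c` to an end at which its column of `ca`, or its row of
`cb`, is non-zero. -/
theorem edgeWeight_le_sum (c : X.EdgeBit ma mb → ZMod 2)
    (ca cb : X.Vertex → Matrix (Fin Δ) (Fin Δ) (ZMod 2))
    (hca : ∀ k g t, (∀ l s, ca (k, l, g * X.stepB l t) s t = 0) →
      ∀ p, c (Sum.inl ((k, g, t), p)) = 0)
    (hcb : ∀ l g s, (∀ k t, cb (k, l, X.stepA k s * g) s t = 0) →
      ∀ q, c (Sum.inr ((l, g, s), q)) = 0) :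
    X.edgeWeight c ≤ ∑ v, (colWeight (ca v) + rowWeight (cb v)) := by
  classical
  rw [Finset.sum_add_distrib, edgeWeight]
  have aux : ∀ (P : Prop) (Q : Bool → Prop), ((∀ b, ¬ Q b) → ¬ P) →
      truthValue P ≤ ∑ b, truthValue (Q b) := by
    intro P Q h
    by_cases hP : P
    · have : ∃ b, Q b := by
        by_contra hne
        exact h (not_exists.1 hne) hP
      obtain ⟨b, hb⟩ := this
      calc truthValue P ≤ truthValue (Q b) := by simp [truthValue, hb, hP]
        _ ≤ _ := Finset.single_le_sum (f := fun b => truthValue (Q b))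
          (fun _ _ => Nat.zero_le _) (Finset.mem_univ b)
    · simp [truthValue, hP]
  refine Nat.add_le_add ?_ ?_
  · simp only [colWeight, ncard_eq_sum_truthValue]
    rw [← sum_hEdge_ends X (fun v t => truthValue (∃ s, ca v s t ≠ 0))]
    refine Finset.sum_le_sum fun e _ => aux _ _ fun h => ?_
    simp only [not_exists, not_not] at h ⊢
    exact hca _ _ _ h
  · simp only [rowWeight, ncard_eq_sum_truthValue]
    rw [← sum_vEdge_ends X (fun v s => truthValue (∃ t, cb v s t ≠ 0))]
    refine Finset.sum_le_sum fun e _ => aux _ _ fun h => ?_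
    simp only [not_exists, not_not] at h ⊢
    exact hcb _ _ _ h

/-! ### The decoded chain -/

/-- The values on faces that a local decoder finds at each vertex. -/
def localFaces (D : Matrix (Fin ma) (Fin mb) (ZMod 2) → Matrix (Fin Δ) (Fin Δ) (ZMod 2))
    (y : X.VertexBit ma mb → ZMod 2) (v : X.Vertex) : Matrix (Fin Δ) (Fin Δ) (ZMod 2) :=
  D (Matrix.of fun p q => y (v, p, q))

/-- The sum over the four vertices of each face of local values. -/
def coSyndrome (φ : X.Vertex → Matrix (Fin Δ) (Fin Δ) (ZMod 2)) : X.Face → ZMod 2 := fun f =>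
  φ (false, false, f.1) f.2.1 f.2.2 + φ (true, false, X.a f.2.1 * f.1) f.2.1 f.2.2 +
    (φ (false, true, f.1 * X.b f.2.2) f.2.1 f.2.2 +
      φ (true, true, X.a f.2.1 * f.1 * X.b f.2.2) f.2.1 f.2.2)

/-- The local values at `V_{00}`, corrected by the codewords on the edges of `E_{0*}` and
`E_{*0}`. -/
def midFaces (HA' : Matrix (Fin ka) (Fin Δ) (ZMod 2)) (HB' : Matrix (Fin kb) (Fin Δ) (ZMod 2))
    (φ : X.Vertex → Matrix (Fin Δ) (Fin Δ) (ZMod 2)) (c : X.EdgeBit ka kb → ZMod 2) :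
    X.Face → ZMod 2 := fun f =>
  φ (false, false, f.1) f.2.1 f.2.2 +
    (∑ p, HA' p f.2.1 * c (Sum.inl ((false, f.1, f.2.2), p)) +
      ∑ q, HB' q f.2.2 * c (Sum.inr ((false, f.1, f.2.1), q)))

/-- The decoded chain. -/
def outChain (HA : Matrix (Fin ma) (Fin Δ) (ZMod 2)) (HB : Matrix (Fin mb) (Fin Δ) (ZMod 2))
    (φ : X.Vertex → Matrix (Fin Δ) (Fin Δ) (ZMod 2)) (u : X.Face → ZMod 2) :
    X.EdgeBit ma mb → ZMod 2
  | Sum.inl ((false, h, t), p) => ∑ s, HA p s * u (h, s, t)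
  | Sum.inl ((true, h, t), p) => ∑ s, HA p s * φ (true, false, h) s t
  | Sum.inr ((false, _, _), _) => 0
  | Sum.inr ((true, h, s), q) =>
      ∑ t, HB q t * (φ (false, true, h) s t + u (h * (X.b t)⁻¹, s, t))

/-- The algebraic core. The table `D` is chosen before the complex, so that one program can contain
it; the last clause holds for every `z` because the co-decoder is correct only up to `im δ⁰`. -/
theorem exists_decoder {CA CB : Submodule (ZMod 2) (Fin Δ → ZMod 2)}
    {HA : Matrix (Fin ma) (Fin Δ) (ZMod 2)} {HB : Matrix (Fin mb) (Fin Δ) (ZMod 2)}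
    {HA' : Matrix (Fin ka) (Fin Δ) (ZMod 2)} {HB' : Matrix (Fin kb) (Fin Δ) (ZMod 2)}
    (hA : IsParityCheck HA CA) (hB : IsParityCheck HB CB)
    (hA' : IsParityCheck HA' (dualCode CA)) (hB' : IsParityCheck HB' (dualCode CB))
    {d₂ : ℝ} (hrob : IsRobust CA CB d₂) :
    ∃ D : Matrix (Fin ma) (Fin mb) (ZMod 2) → Matrix (Fin Δ) (Fin Δ) (ZMod 2),
      ∀ (X : LRCayley.{u} Δ) (c : X.EdgeBit ma mb → ZMod 2),
        ∃ c' : X.EdgeBit ka kb → ZMod 2,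
          (X.bdry2 HA' HB').transpose.mulVec c' =
            X.coSyndrome (X.localFaces D ((X.bdry1 HA HB).mulVec c)) ∧
          (0 < d₂ → d₂ * (X.edgeWeight c' : ℝ) ≤ 4 * Δ * (X.edgeWeight c : ℝ)) ∧
          ∀ z : X.VertexBit ka kb → ZMod 2, ∃ w : X.Face → ZMod 2,
            X.outChain HA HB (X.localFaces D ((X.bdry1 HA HB).mulVec c))
              (X.midFaces HA' HB' (X.localFaces D ((X.bdry1 HA HB).mulVec c))
                (c' + (X.bdry1 HA' HB').transpose.mulVec z)) =
              c + (X.bdry2 HA HB).mulVec w := by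
  obtain ⟨RA, hRA⟩ := hA.exists_right_inverse
  obtain ⟨RB, hRB⟩ := hB.exists_right_inverse
  obtain ⟨SA, hSA⟩ := hA'.exists_encoder_inverse
  obtain ⟨SB, hSB⟩ := hB'.exists_encoder_inverse
  have hAA := hA.mul_transpose_dual hA'
  have hBB := hB.mul_transpose_dual hB'
  obtain ⟨D, hD⟩ := exists_local_decoder hA hB hrob hRA hRB
  refine ⟨D, fun X c => ?_⟩
  choose ca hca cb hcb hDv hw using fun v => hD (X.hView c v) (X.vView c v)
  set φ := X.localFaces D ((X.bdry1 HA HB).mulVec c) with hφdef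
  -- A local guess is the lift from the horizontal edge, plus the lift from the vertical edge, plus
  -- the local codewords.
  have hφ : ∀ k l h s t, φ (k, l, h) s t =
      ∑ p, RA s p * c (Sum.inl ((k, h * (X.stepB l t)⁻¹, t), p)) +
        ∑ q, RB t q * c (Sum.inr ((l, (X.stepA k s)⁻¹ * h, s), q)) +
        ca (k, l, h) s t + cb (k, l, h) s t := by
    intro k l h s t
    have hsyn : (Matrix.of fun p q => (X.bdry1 HA HB).mulVec c ((k, l, h), p, q)) =
        X.hView c (k, l, h) * HBᵀ + HA * X.vView c (k, l, h) := by
      ext p q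
      rw [Matrix.of_apply, bdry1_mulVec]
      simp [Matrix.mul_apply, hView, vView]
    rw [hφdef, localFaces, hsyn, hDv]
    simp [Matrix.mul_apply, hView, vView, mul_comm]
  have kill_ca : ∀ v t p, ∑ s, HA p s * ca v s t = 0 := fun v t p =>
    congrFun ((hA.1 _).1 ((hca v).1 t)) p
  have kill_cb : ∀ v s q, ∑ t, HB q t * cb v s t = 0 := fun v s q =>
    congrFun ((hB.1 _).1 ((hcb v).2 s)) q
  have lift_A : ∀ (y : Fin ma → ZMod 2) p, ∑ s, HA p s * ∑ p', RA s p' * y p' = y p := by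
    intro y p
    have : HA.mulVec (RA.mulVec y) = y := by rw [Matrix.mulVec_mulVec, hRA, Matrix.one_mulVec]
    exact congrFun this p
  have lift_B : ∀ (y : Fin mb → ZMod 2) q, ∑ t, HB q t * ∑ q', RB t q' * y q' = y q := by
    intro y q
    have : HB.mulVec (RB.mulVec y) = y := by rw [Matrix.mulVec_mulVec, hRB, Matrix.one_mulVec]
    exact congrFun this q
  -- On each edge the codewords seen from its two ends are added and written in terms of the rows of
  -- `HA'` or `HB'`; `SA` and `SB` extract the coefficients.
  let c' : X.EdgeBit ka kb → ZMod 2 := fun x => match x with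
    | Sum.inl (e, p) =>
        ∑ l, SA.mulVec (fun s => ca (e.1, l, e.2.1 * X.stepB l e.2.2) s e.2.2) p
    | Sum.inr (e, q) =>
        ∑ k, SB.mulVec (fun t => cb (k, e.1, X.stepA k e.2.2 * e.2.1) e.2.2 t) q
  have hα : ∀ k g t s, ∑ p, HA' p s * c' (Sum.inl ((k, g, t), p)) =
      ∑ l, ca (k, l, g * X.stepB l t) s t := by
    intro k g t s
    simp only [c', Finset.mul_sum]
    rw [Finset.sum_comm]
    exact Finset.sum_congr rfl fun l _ => congrFun (hSA _ ((hca (k, l, g * X.stepB l t)).1 t)) s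
  have hβ : ∀ l g s t, ∑ q, HB' q t * c' (Sum.inr ((l, g, s), q)) =
      ∑ k, cb (k, l, X.stepA k s * g) s t := by
    intro l g s t
    simp only [c', Finset.mul_sum]
    rw [Finset.sum_comm]
    exact Finset.sum_congr rfl fun k _ => congrFun (hSB _ ((hcb (k, l, X.stepA k s * g)).2 s)) t
  refine ⟨c', ?_, fun hd₂ => ?_, fun z => ?_⟩
  · ext ⟨g, s, t⟩
    rw [bdry2_transpose_mulVec]
    simp only [hα, hβ, coSyndrome, hφ, Fintype.sum_bool, stepA, stepB, if_true, Bool.false_eq_true,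
      if_false, one_mul, mul_one, inv_one, mul_assoc, mul_inv_cancel, inv_mul_cancel_left]
    -- Each lift occurs at two corners of the face and cancels in characteristic 2.
    grind
  · have h1 : (X.edgeWeight c' : ℝ) ≤
        ∑ v, ((colWeight (ca v) : ℝ) + (rowWeight (cb v) : ℝ)) := by
      have := X.edgeWeight_le_sum c' ca cb
        (by
          intro k g t h p
          refine Finset.sum_eq_zero fun l _ => ?_
          simp only [h l]
          exact congrFun (Matrix.mulVec_zero SA) p)
        (by
          intro l g s h q
          refine Finset.sum_eq_zero fun k _ => ?_
          simp only [h k]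
          exact congrFun (Matrix.mulVec_zero SB) q)
      exact_mod_cast this
    have h2 : ∑ v, ((colWeight (X.hView c v) : ℝ) + (rowWeight (X.vView c v) : ℝ)) =
        2 * X.edgeWeight c := by
      exact_mod_cast X.sum_view_weight c
    calc d₂ * (X.edgeWeight c' : ℝ)
        ≤ d₂ * ∑ v, ((colWeight (ca v) : ℝ) + (rowWeight (cb v) : ℝ)) := by gcongr
      _ ≤ ∑ v, 2 * Δ * ((colWeight (X.hView c v) : ℝ) + (rowWeight (X.vView c v) : ℝ)) := by
          rw [Finset.mul_sum]
          exact Finset.sum_le_sum fun v _ => hw v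
      _ = 4 * Δ * X.edgeWeight c := by rw [← Finset.mul_sum, h2]; ring
  -- The ambiguity `z`, encoded at each vertex as a word of `C_A ⊗ C_B`; both `HA` and `HB` kill it.
  · let Z : X.Vertex → Fin Δ → Fin Δ → ZMod 2 := fun v s t =>
      ∑ p, ∑ q, HA' p s * (HB' q t * z (v, p, q))
    have kill_ZA : ∀ v t p, ∑ s, HA p s * Z v s t = 0 := by
      intro v t p
      simp only [Z, Finset.mul_sum]
      rw [Finset.sum_comm]
      refine Finset.sum_eq_zero fun p' _ => ?_
      rw [Finset.sum_comm]
      refine Finset.sum_eq_zero fun q _ => ?_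
      have := congrFun (congrFun hAA p) p'
      simp only [Matrix.mul_apply, Matrix.transpose_apply, Matrix.zero_apply] at this
      simp only [← mul_assoc, ← Finset.sum_mul, this, zero_mul]
    have kill_ZB : ∀ v s q, ∑ t, HB q t * Z v s t = 0 := by
      intro v s q
      simp only [Z, Finset.mul_sum]
      rw [Finset.sum_comm]
      refine Finset.sum_eq_zero fun p' _ => ?_
      rw [Finset.sum_comm]
      refine Finset.sum_eq_zero fun q' _ => ?_
      have := congrFun (congrFun hBB q) q'
      simp only [Matrix.mul_apply, Matrix.transpose_apply, Matrix.zero_apply] at this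
      simp only [mul_left_comm _ (HA' _ _), ← Finset.mul_sum]
      simp only [← mul_assoc, ← Finset.sum_mul, this, zero_mul, mul_zero]
    have hZA : ∀ k g t s, ∑ p, HA' p s *
        (X.bdry1 HA' HB').transpose.mulVec z (Sum.inl ((k, g, t), p)) =
          ∑ l, Z (k, l, g * X.stepB l t) s t := by
      intro k g t s
      simp only [bdry1_transpose_mulVec_inl, Z, Finset.mul_sum]
      rw [Finset.sum_comm]
    have hZB : ∀ l g s t, ∑ q, HB' q t *
        (X.bdry1 HA' HB').transpose.mulVec z (Sum.inr ((l, g, s), q)) =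
          ∑ k, Z (k, l, X.stepA k s * g) s t := by
      intro l g s t
      simp only [bdry1_transpose_mulVec_inr, Z, Finset.mul_sum]
      rw [Finset.sum_comm]
      refine Finset.sum_congr rfl fun k _ => ?_
      rw [Finset.sum_comm]
      exact Finset.sum_congr rfl fun p _ => Finset.sum_congr rfl fun q _ => by ring
    -- `w` lifts the error on `E_{*0}`. Its other two terms vanish under `HB`, and they are what the
    -- guess at `V₁₀` and the corrected guess at `V₀₀` have in common.
    let w : X.Face → ZMod 2 := fun f =>
      ∑ q, RB f.2.2 q * c (Sum.inr ((false, f.1, f.2.1), q)) +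
        cb (true, false, X.a f.2.1 * f.1) f.2.1 f.2.2 +
        Z (true, false, X.a f.2.1 * f.1) f.2.1 f.2.2
    -- The correction cancels the codewords at `V₀₀` and brings in those at `V₀₁` and `V₁₀`; the two
    -- copies of `Z` at `V₀₀` cancel as well.
    have hmid : ∀ g s t, X.midFaces HA' HB' φ
        (c' + (X.bdry1 HA' HB').transpose.mulVec z) (g, s, t) =
        ∑ p, RA s p * c (Sum.inl ((false, g, t), p)) + ca (false, true, g * X.b t) s t +
          Z (false, true, g * X.b t) s t + w (g, s, t) := by
      intro g s t
      simp only [midFaces, Pi.add_apply, mul_add, Finset.sum_add_distrib, hα, hβ, hZA, hZB, hφ, w,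
        Fintype.sum_bool, stepA, stepB, if_true, Bool.false_eq_true, if_false, one_mul, mul_one,
        inv_one]
      grind
    refine ⟨w, ?_⟩
    ext x
    rcases x with ⟨⟨k, h, t⟩, p⟩ | ⟨⟨l, h, s⟩, q⟩
    · rw [Pi.add_apply, bdry2_mulVec_inl]
      cases k
      · simp only [outChain, hmid, stepA, Bool.false_eq_true, if_false, inv_one, one_mul, mul_add,
          Finset.sum_add_distrib, kill_ca, kill_ZA, lift_A, add_zero]
      · have : ∀ s, φ (true, false, h) s t = ∑ p, RA s p * c (Sum.inl ((true, h, t), p)) +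
            ca (true, false, h) s t + Z (true, false, h) s t + w ((X.a s)⁻¹ * h, s, t) := by
          intro s
          simp only [hφ, w, stepA, stepB, if_true, Bool.false_eq_true, if_false, mul_one, inv_one,
            mul_inv_cancel_left]
          grind
        simp only [outChain, this, stepA, if_true, mul_add, Finset.sum_add_distrib, kill_ca,
          kill_ZA, lift_A, add_zero]
    · rw [Pi.add_apply, bdry2_mulVec_inr]
      cases l
      -- On `E_{*0}` the boundary of `w` equals `c`, which is why the decoded chain may be zero
      -- there.
      · have h0 : ∑ t, HB q t * w (h, s, t) = c (Sum.inr ((false, h, s), q)) := by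
          simp only [w, mul_add, Finset.sum_add_distrib, kill_cb, kill_ZB, lift_B, add_zero]
        simp only [outChain, stepB, Bool.false_eq_true, if_false, inv_one, mul_one, h0]
        exact (CharTwo.add_self_eq_zero _).symm
      · have : ∀ t, φ (false, true, h) s t + X.midFaces HA' HB' φ
              (c' + (X.bdry1 HA' HB').transpose.mulVec z) (h * (X.b t)⁻¹, s, t) =
            ∑ q, RB t q * c (Sum.inr ((true, h, s), q)) + cb (false, true, h) s t +
              Z (false, true, h) s t + w (h * (X.b t)⁻¹, s, t) := by
          intro t
          simp only [hmid, hφ, stepA, stepB, if_true, Bool.false_eq_true, if_false, one_mul,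
            inv_one, inv_mul_cancel_right]
          grind
        simp only [outChain, this, stepB, if_true, mul_add, Finset.sum_add_distrib, kill_cb,
          kill_ZB, lift_B, add_zero]

end LRCayley

/-! ### Addresses -/

/-- Addresses are mixed-radix numerals; this strips the last digit. -/
theorem Nat.mul_add_inj_of_lt {m a b p q : ℕ} (hp : p < m) (hq : q < m)
    (h : a * m + p = b * m + q) : a = b ∧ p = q := by
  have hm : 0 < m := by omega
  have h1 : a = b := by
    have := congrArg (· / m) h
    simpa [mul_comm _ m, Nat.mul_add_div hm, Nat.div_eq_of_lt hp, Nat.div_eq_of_lt hq] using this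
  subst h1
  exact ⟨rfl, by omega⟩

namespace LRCayley

variable {Δ : ℕ} (X : LRCayley.{u} Δ) {ma mb ka kb : ℕ}

theorem order_pos : 1 ≤ X.order := Fintype.card_pos

theorem tableCell_injective : Function.Injective X.tableCell := by
  rintro ⟨g, s⟩ ⟨g', s'⟩ h
  obtain ⟨h1, h2⟩ := Nat.mul_add_inj_of_lt s.2 s'.2 h
  simpa [Fin.val_inj] using And.intro h1 h2

theorem faceCell_injective : Function.Injective X.faceCell := by
  rintro ⟨g, s, t⟩ ⟨g', s', t'⟩ h
  obtain ⟨h1, h2⟩ := Nat.mul_add_inj_of_lt t.2 t'.2 h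
  obtain ⟨h3, h4⟩ := Nat.mul_add_inj_of_lt s.2 s'.2 h1
  simpa [Fin.val_inj] using And.intro h3 (And.intro h4 h2)

theorem edgeCell_injective (m : ℕ) : Function.Injective (X.edgeCell m) := by
  rintro ⟨⟨k, g, t⟩, p⟩ ⟨⟨k', g', t'⟩, p'⟩ h
  obtain ⟨h1, h2⟩ := Nat.mul_add_inj_of_lt p.2 p'.2 h
  obtain ⟨h3, h4⟩ := Nat.mul_add_inj_of_lt t.2 t'.2 h1
  obtain ⟨h5, h6⟩ := Nat.mul_add_inj_of_lt (X.idx g).2 (X.idx g').2 h3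
  have hk : k = k' := by cases k <;> cases k' <;> simp_all
  simpa [Fin.val_inj, hk] using And.intro (And.intro h6 h4) h2

theorem vertexCell_injective :
    Function.Injective (X.vertexCell : X.VertexBit ma mb → ℕ) := by
  rintro ⟨⟨k, l, g⟩, p, q⟩ ⟨⟨k', l', g'⟩, p', q'⟩ h
  obtain ⟨h1, h2⟩ := Nat.mul_add_inj_of_lt q.2 q'.2 h
  obtain ⟨h3, h4⟩ := Nat.mul_add_inj_of_lt p.2 p'.2 h1
  obtain ⟨h5, h6⟩ := Nat.mul_add_inj_of_lt (X.idx g).2 (X.idx g').2 h3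
  have hkl : k = k' ∧ l = l' := by cases k <;> cases k' <;> cases l <;> cases l' <;> simp_all
  simpa [Fin.val_inj, hkl.1, hkl.2] using And.intro h6 (And.intro h4 h2)

end LRCayley

/-! ### Address expressions and array contents -/

namespace RAM

/-- The address of a cell of a table. -/
def tableAddr (Δ : ℕ) (e : Expr) (s : ℕ) : Expr := .bin .add (.bin .mul e (.lit Δ)) (.lit s)

/-- The address of a face. -/
def faceAddr (Δ : ℕ) (e : Expr) (s t : ℕ) : Expr := tableAddr Δ (tableAddr Δ e s) t

/-- The address of a group element in the block with number `i`, where register `q` holds `|G|`. -/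
def blockAddr (q i : ℕ) (e : Expr) : Expr := .bin .add (.bin .mul (.lit i) (.get q)) e

/-- The address of a bit of an edge. -/
def edgeAddr (q Δ m : ℕ) (k : Bool) (e : Expr) (t p : ℕ) : Expr :=
  tableAddr m (tableAddr Δ (blockAddr q k.toNat e) t) p

/-- The address of a bit of a vertex. -/
def vertexAddr (q ma mb : ℕ) (k l : Bool) (e : Expr) (x y : ℕ) : Expr :=
  tableAddr mb (tableAddr ma (blockAddr q (2 * k.toNat + l.toNat) e) x) y

variable {Δ : ℕ} (X : LRCayley.{u} Δ) {s : State} {e : Expr} {g : X.G} {q : ℕ}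

theorem eval_tableAddr (he : e.eval s = X.idx g) (i : Fin Δ) :
    (tableAddr Δ e i).eval s = X.tableCell (g, i) := by
  simp [tableAddr, Expr.eval, Op.apply, he, LRCayley.tableCell]

theorem eval_faceAddr (he : e.eval s = X.idx g) (i j : Fin Δ) :
    (faceAddr Δ e i j).eval s = X.faceCell (g, i, j) := by
  simp [faceAddr, tableAddr, Expr.eval, Op.apply, he, LRCayley.faceCell]

theorem eval_edgeAddr (hq : s.reg q = X.order) (he : e.eval s = X.idx g) {m : ℕ} (k : Bool)
    (t : Fin Δ) (p : Fin m) :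
    (edgeAddr q Δ m k e t p).eval s = X.edgeCell m ((k, g, t), p) := by
  simp [edgeAddr, blockAddr, tableAddr, Expr.eval, Op.apply, he, hq, LRCayley.edgeCell]

theorem eval_vertexAddr (hq : s.reg q = X.order) (he : e.eval s = X.idx g) {ma mb : ℕ}
    (k l : Bool) (x : Fin ma) (y : Fin mb) :
    (vertexAddr q ma mb k l e x y).eval s = X.vertexCell ((k, l, g), x, y) := by
  simp [vertexAddr, blockAddr, tableAddr, Expr.eval, Op.apply, he, hq, LRCayley.vertexCell]

/-! ### Contents of arrays -/

/-- Array `m` holds the table of `g b_t`. -/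
def HoldsTable (m : ℕ) (s : State) : Prop :=
  ∀ g t, s.mem m (X.tableCell (g, t)) = X.idx (g * X.b t)

/-- Array `m` holds values on the faces at each vertex. -/
def HoldsLocal (m : ℕ) (φ : X.Vertex → Matrix (Fin Δ) (Fin Δ) (ZMod 2)) (s : State) : Prop :=
  ∀ k l g i j, s.mem m (X.vertexCell ((k, l, g), i, j)) = (φ (k, l, g) i j).val

/-- Array `m` holds values on the faces. -/
def HoldsFaces (m : ℕ) (u : X.Face → ZMod 2) (s : State) : Prop :=
  ∀ g i j, s.mem m (X.faceCell (g, i, j)) = (u (g, i, j)).val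

/-- Array `m` holds values on edges. -/
def HoldsEdges (m : ℕ) {d : ℕ} (c : (Bool × X.G × Fin Δ) × Fin d → ZMod 2) (s : State) : Prop :=
  ∀ x, s.mem m (X.edgeCell d x) = (c x).val

variable {X}

theorem eval_read_table {m : ℕ} (h : HoldsTable X m s) (he : e.eval s = X.idx g) (t : Fin Δ) :
    (Expr.read m (tableAddr Δ e t)).eval s = X.idx (g * X.b t) := by
  rw [Expr.eval, eval_tableAddr X he, h]

/-- An expression for the number of `g b_t⁻¹`, with the table of `g b_t` in array `m`. -/
noncomputable def preimageB (Δ m : ℕ) (e : Expr) (t : Fin Δ) : Expr :=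
  Expr.sum fun t' : Fin Δ =>
    .bin .mul (.bin .eq (.read m (tableAddr Δ (.read m (tableAddr Δ e t')) t)) e)
      (.read m (tableAddr Δ e t'))

/-- Since `B` is inverse-closed, `g b_t⁻¹` is itself a neighbour `g b_{t'}` of `g`. It is the only
one that `b_t` sends back to `g`, so exactly one summand survives. -/
theorem eval_preimageB {m : ℕ} (h : HoldsTable X m s) (he : e.eval s = X.idx g) (t : Fin Δ) :
    (preimageB Δ m e t).eval s = X.idx (g * (X.b t)⁻¹) := by
  obtain ⟨t₀, ht₀⟩ := X.b_inv t
  have hterm : ∀ t' : Fin Δ, (Expr.bin .mul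
      (.bin .eq (.read m (tableAddr Δ (.read m (tableAddr Δ e t')) t)) e)
      (.read m (tableAddr Δ e t'))).eval s =
      (if t' = t₀ then 1 else 0) * (X.idx (g * X.b t') : ℕ) := by
    intro t'
    have h1 := eval_read_table h he t'
    have h2 := eval_read_table h h1 t
    have : (X.idx (g * X.b t' * X.b t) : ℕ) = X.idx g ↔ t' = t₀ := by
      rw [Fin.val_inj, X.idx.injective.eq_iff, mul_assoc, mul_eq_left, mul_eq_one_iff_eq_inv,
        ← ht₀, X.b_injective.eq_iff]
    have hbin : ∀ o e₁ e₂, (Expr.bin o e₁ e₂).eval s = o.apply (e₁.eval s) (e₂.eval s) :=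
      fun _ _ _ => rfl
    rw [hbin, hbin, h1, h2, he]
    simp only [Op.apply, this]
  rw [preimageB, Expr.eval_sum, Finset.sum_congr rfl fun t' _ => hterm t']
  simp [ht₀]

theorem HoldsTable.congr {m m' r : ℕ} {s' : State} (h : HoldsTable X m s)
    (ha : AgreeOff m' r s s') (hm : m ≠ m') : HoldsTable X m s' := by
  unfold HoldsTable; rw [ha.2 m hm]; exact h

theorem HoldsLocal.congr {m m' r : ℕ} {s' : State}
    {φ : X.Vertex → Matrix (Fin Δ) (Fin Δ) (ZMod 2)} (h : HoldsLocal X m φ s)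
    (ha : AgreeOff m' r s s') (hm : m ≠ m') : HoldsLocal X m φ s' := by
  unfold HoldsLocal; rw [ha.2 m hm]; exact h

theorem HoldsFaces.congr {m m' r : ℕ} {s' : State} {u : X.Face → ZMod 2}
    (h : HoldsFaces X m u s) (ha : AgreeOff m' r s s') (hm : m ≠ m') : HoldsFaces X m u s' := by
  unfold HoldsFaces; rw [ha.2 m hm]; exact h

theorem HoldsEdges.congr {m m' r : ℕ} {s' : State} {d : ℕ}
    {c : (Bool × X.G × Fin Δ) × Fin d → ZMod 2}
    (h : HoldsEdges X m c s) (ha : AgreeOff m' r s s') (hm : m ≠ m') : HoldsEdges X m c s' := by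
  unfold HoldsEdges; rw [ha.2 m hm]; exact h

theorem holdsTable_start (w : ℕ → ℕ) : HoldsTable X 1 (X.start w) := fun g t => by
  simp only [LRCayley.start]
  rw [X.tableCell_injective.extend_apply]

theorem start_mem_zero (w : ℕ → ℕ) (g : X.G) (i : Fin Δ) :
    (X.start w).mem 0 (X.tableCell (g, i)) = X.idx (X.a i * g) := by
  simp only [LRCayley.start]
  rw [X.tableCell_injective.extend_apply]

theorem zmod_two_val_lt_pow {n k : ℕ} (hn : 1 ≤ n) (hk : 1 ≤ k) (x : ZMod 2) :
    x.val < (n + 1) ^ k :=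
  lt_of_lt_of_le (ZMod.val_lt x) (calc 2 ≤ n + 1 := by omega
    _ ≤ (n + 1) ^ k := Nat.le_self_pow (by omega) _)

theorem extend_lt {α : Type*} {f : α → ℕ} (hf : Function.Injective f) {v : α → ℕ} {B : ℕ}
    (hv : ∀ x, v x < B) (hB : 0 < B) (i : ℕ) : Function.extend f v (fun _ => 0) i < B := by
  by_cases h : ∃ x, f x = i
  · obtain ⟨x, rfl⟩ := h
    rw [hf.extend_apply]
    exact hv x
  · rw [Function.extend_apply' _ _ _ h]
    exact hB

theorem bounded_start {w : ℕ → ℕ} (hw : ∀ i, w i < X.order + 1) :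
    Bounded ((X.order + 1) ^ 1) (X.start w) := by
  rw [pow_one]
  have hidx : ∀ g : X.G, (X.idx g : ℕ) < X.order + 1 := fun g => (X.idx g).2.trans (by
    simp [LRCayley.order])
  refine ⟨fun x => ?_, fun m i => ?_⟩
  · simp only [LRCayley.start]
    split <;> omega
  · match m with
    | 0 =>
      simp only [LRCayley.start]
      exact extend_lt X.tableCell_injective (fun x => hidx _) (by omega) i
    | 1 =>
      simp only [LRCayley.start]
      exact extend_lt X.tableCell_injective (fun x => hidx _) (by omega) i
    | 2 => exact hw i
    | m + 3 => exact Nat.succ_pos _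

variable (X) in
/-- The state agrees with the initial one on registers and arrays below `M`, but for array `2`;
register `M + 1` holds `|G|`. -/
structure Prepared (M : ℕ) (s : State) : Prop where
  order : s.reg (M + 1) = X.order
  reg : ∀ x < M, s.reg x = (X.start fun _ => 0).reg x
  mem : ∀ m < M, m ≠ 2 → s.mem m = (X.start fun _ => 0).mem m
  bounded : Bounded ((X.order + 1) ^ 1) s

theorem Prepared.congr {M m : ℕ} {s' : State} (h : Prepared X M s) (ha : AgreeOff m M s s')
    (hm : m = 2 ∨ M ≤ m) (hb : Bounded ((X.order + 1) ^ 1) s') : Prepared X M s' where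
  order := by rw [ha.1 _ (by omega), h.order]
  reg x hx := by rw [ha.1 x (by omega), h.reg x hx]
  mem m' hm' h2 := by rw [ha.2 m' (by omega), h.mem m' hm' h2]
  bounded := hb

end RAM

/-! ### The decoder -/

namespace RAM

open LRCayley

/-! ### Programs that prepare the input of the co-decoder -/

section Preprocessing

variable {Δ ma mb : ℕ} {J : Type*} (X : J → LRCayley.{u} Δ)
  (y : ∀ j, (X j).VertexBit ma mb → ZMod 2)
  (D : Matrix (Fin ma) (Fin mb) (ZMod 2) → Matrix (Fin Δ) (Fin Δ) (ZMod 2)) (M : ℕ)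

/-- The co-decoder may overwrite register `0`, so `|G|` is saved in a register beyond its reach. -/
theorem realizes_init :
    Realizes (fun j => (X j).order) (.assign (M + 1) (.get 0))
      (fun j s => s = (X j).start ((X j).vertexArray (y j)))
      (fun j s => Prepared (X j) M s ∧ s.mem 2 = (X j).vertexArray (y j)) := by
  refine ⟨1, 2, ?_⟩
  rintro j _ rfl K hK
  have hb : Bounded (((X j).order + 1) ^ 1) ((X j).start ((X j).vertexArray (y j))) :=
    bounded_start fun i => by
      refine extend_lt (X j).vertexCell_injective (fun x => ?_) (by omega) i
      have := (X j).order_pos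
      have := ZMod.val_lt (y j x)
      omega
  have hn := (X j).order_pos
  refine ⟨_, _, .assign _ _ _ ((Expr.eval_lt_and_fits hn hb _).2 K hK), ?_, ?_, rfl⟩
  · simp only [Expr.cost]; omega
  · refine ⟨?_, fun x hx => ?_, fun m hm h2 => ?_, ?_⟩
    · simp [Expr.eval, start]
    · have : x ≠ M + 1 := by omega
      simp [this, start]
    · simp only [start]
      match m with
      | 0 => rfl
      | 1 => rfl
      | 2 => exact absurd rfl h2
      | m + 3 => rfl
    · exact hb.assign _ (by simp [Expr.eval, start])

/-- Fill array `M + 2` with the local values at each vertex. -/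
noncomputable def localCmd : Cmd :=
  fill (β := Bool × Bool × Fin Δ × Fin Δ) (M + 1) M (M + 2)
    (fun b => vertexAddr (M + 1) Δ Δ b.1 b.2.1 (.get M) b.2.2.1 b.2.2.2)
    (fun b => Expr.bool (ι := Fin ma × Fin mb)
      (fun x => .read 2 (vertexAddr (M + 1) ma mb b.1 b.2.1 (.get M) x.1 x.2))
      (fun x => D (Matrix.of fun p q => x (p, q)) b.2.2.1 b.2.2.2))

theorem realizes_local (hM : 5 ≤ M) :
    Realizes (fun j => (X j).order) (localCmd D M)
      (fun j s => Prepared (X j) M s ∧ s.mem 2 = (X j).vertexArray (y j))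
      (fun j s => Prepared (X j) M s ∧ s.mem 2 = (X j).vertexArray (y j) ∧
        HoldsLocal (X j) (M + 2) ((X j).localFaces D (y j)) s) := by
  refine Realizes.fill (fun j => (X j).order_pos) (fun j => (X j).idx) (by omega) _ _ le_rfl
    (fun j x => (X j).vertexCell ((x.2.1, x.2.2.1, x.1), x.2.2.2.1, x.2.2.2.2))
    (fun j x => ((X j).localFaces D (y j) (x.2.1, x.2.2.1, x.1) x.2.2.2.1 x.2.2.2.2).val)
    (fun j => ?_) (fun j x => zmod_two_val_lt_pow (X j).order_pos le_rfl _) ?_ ?_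
  · rintro ⟨g, k, l, a, b⟩ ⟨g', k', l', a', b'⟩ h
    have := (X j).vertexCell_injective h
    simp only [Prod.mk.injEq] at this ⊢
    tauto
  · rintro j s ⟨hp, h2⟩
    refine ⟨hp.order, hp.bounded, ?_⟩
    rintro g ⟨k, l, a, b⟩ s' ha hr
    have hq : s'.reg (M + 1) = (X j).order := by rw [ha.1 _ (by omega), hp.order]
    have hg : (Expr.get M).eval s' = (X j).idx g := hr
    refine ⟨eval_vertexAddr _ hq hg k l a b, ?_⟩
    refine Expr.eval_bool _ _ (b := fun x : Fin ma × Fin mb => y j ((k, l, g), x.1, x.2)) fun x => ?_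
    rw [Expr.eval, eval_vertexAddr _ hq hg, ha.2 2 (by omega), h2]
    exact (X j).vertexCell_injective.extend_apply _ _ _
  · rintro j s s' ⟨hp, h2⟩ hb ha hc -
    exact ⟨hp.congr ha (by omega) hb, by rw [ha.2 2 (by omega), h2], fun k l g a b =>
      hc (g, k, l, a, b)⟩

/-- Copy the table of `g b_t` to array `M + 1`. -/
noncomputable def tableCmd (Δ M : ℕ) : Cmd :=
  fill (β := Fin Δ) (M + 1) M (M + 1) (fun t => tableAddr Δ (.get M) t)
    (fun t => .read 1 (tableAddr Δ (.get M) t))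

variable (φ : ∀ j, (X j).Vertex → Matrix (Fin Δ) (Fin Δ) (ZMod 2))

/-- The copy survives the co-decoder, which may destroy array `1`; the last loop needs it to divide
by `b_t`. -/
theorem realizes_table (hM : 5 ≤ M) :
    Realizes (fun j => (X j).order) (tableCmd Δ M)
      (fun j s => Prepared (X j) M s ∧ s.mem 2 = (X j).vertexArray (y j) ∧
        HoldsLocal (X j) (M + 2) (φ j) s)
      (fun j s => Prepared (X j) M s ∧ s.mem 2 = (X j).vertexArray (y j) ∧
        HoldsLocal (X j) (M + 2) (φ j) s ∧ HoldsTable (X j) (M + 1) s) := by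
  refine Realizes.fill (fun j => (X j).order_pos) (fun j => (X j).idx) (by omega) _ _ le_rfl
    (fun j x => (X j).tableCell x) (fun j x => (X j).idx (x.1 * (X j).b x.2))
    (fun j => (X j).tableCell_injective) (fun j x => ?_) ?_ ?_
  · rw [pow_one]
    exact Nat.lt_succ_of_lt ((X j).idx _).2
  · rintro j s ⟨hp, h2, hl⟩
    refine ⟨hp.order, hp.bounded, ?_⟩
    rintro g t s' ha hr
    have hg : (Expr.get M).eval s' = (X j).idx g := hr
    refine ⟨eval_tableAddr _ hg t, eval_read_table ?_ hg t⟩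
    unfold HoldsTable
    rw [ha.2 1 (by omega), hp.mem 1 (by omega) (by omega)]
    exact holdsTable_start _
  · rintro j s s' ⟨hp, h2, hl⟩ hb ha hc -
    exact ⟨hp.congr ha (by omega) hb, by rw [ha.2 2 (by omega), h2], hl.congr ha (by omega),
      fun g t => hc (g, t)⟩

/-- Clear the syndrome in array `2`. -/
noncomputable def clearCmd (ma mb M : ℕ) : Cmd :=
  fill (β := Bool × Bool × Fin ma × Fin mb) (M + 1) M 2
    (fun b => vertexAddr (M + 1) ma mb b.1 b.2.1 (.get M) b.2.2.1 b.2.2.2) (fun _ => .lit 0)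

/-- The co-decoder expects zeros in array `2` outside the face cells, and the syndrome may occupy
other cells than these. -/
theorem realizes_clear (hM : 5 ≤ M) :
    Realizes (fun j => (X j).order) (clearCmd ma mb M)
      (fun j s => Prepared (X j) M s ∧ s.mem 2 = (X j).vertexArray (y j) ∧
        HoldsLocal (X j) (M + 2) (φ j) s ∧ HoldsTable (X j) (M + 1) s)
      (fun j s => Prepared (X j) M s ∧ s.mem 2 = (fun _ => 0) ∧
        HoldsLocal (X j) (M + 2) (φ j) s ∧ HoldsTable (X j) (M + 1) s) := by
  refine Realizes.fill (fun j => (X j).order_pos) (fun j => (X j).idx) (by omega) _ _ le_rfl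
    (fun j x => (X j).vertexCell (ma := ma) (mb := mb)
      ((x.2.1, x.2.2.1, x.1), x.2.2.2.1, x.2.2.2.2))
    (fun j x => 0) (fun j => ?_) (fun j x => by positivity) ?_ ?_
  · rintro ⟨g, k, l, a, b⟩ ⟨g', k', l', a', b'⟩ h
    have := (X j).vertexCell_injective h
    simp only [Prod.mk.injEq] at this ⊢
    tauto
  · rintro j s ⟨hp, h2, hl⟩
    refine ⟨hp.order, hp.bounded, ?_⟩
    rintro g ⟨k, l, a, b⟩ s' ha hr
    have hq : s'.reg (M + 1) = (X j).order := by rw [ha.1 _ (by omega), hp.order]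
    have hg : (Expr.get M).eval s' = (X j).idx g := hr
    exact ⟨eval_vertexAddr _ hq hg k l a b, rfl⟩
  · rintro j s s' ⟨hp, h2, hl, ht⟩ hb ha hc hu
    refine ⟨hp.congr ha (by omega) hb, ?_, hl.congr ha (by omega), ht.congr ha (by omega)⟩
    ext i
    by_cases h : ∃ x : (X j).VertexBit ma mb, (X j).vertexCell x = i
    · obtain ⟨⟨⟨k, l, g⟩, a, b⟩, rfl⟩ := h
      exact hc (g, k, l, a, b)
    · rw [hu i fun x hx => h ⟨_, hx.symm⟩, h2]
      exact Function.extend_apply' _ _ _ h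

/-- The number of the vertex of type `(k, l)` of the face `(g, s, t)`. -/
def cornerExpr (Δ M : ℕ) (k l : Bool) (s t : Fin Δ) : Expr :=
  let e := if k then .read 0 (tableAddr Δ (.get M) s) else .get M
  if l then .read 1 (tableAddr Δ e t) else e

/-- Write into array `2` the sum of the local values at the vertices of each face. -/
noncomputable def coSyndromeCmd (Δ M : ℕ) : Cmd :=
  fill (β := Fin Δ × Fin Δ) (M + 1) M 2 (fun b => faceAddr Δ (.get M) b.1 b.2)
    (fun b => Expr.bool (ι := Bool × Bool)
      (fun x => .read (M + 2)
        (vertexAddr (M + 1) Δ Δ x.1 x.2 (cornerExpr Δ M x.1 x.2 b.1 b.2) b.1 b.2))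
      (fun x => x (false, false) + x (true, false) + (x (false, true) + x (true, true))))

theorem realizes_coSyndrome (hM : 5 ≤ M) :
    Realizes (fun j => (X j).order) (coSyndromeCmd Δ M)
      (fun j s => Prepared (X j) M s ∧ s.mem 2 = (fun _ => 0) ∧
        HoldsLocal (X j) (M + 2) (φ j) s ∧ HoldsTable (X j) (M + 1) s)
      (fun j s => Prepared (X j) M s ∧
        s.mem 2 = (X j).faceArray ((X j).coSyndrome (φ j)) ∧
        HoldsLocal (X j) (M + 2) (φ j) s ∧ HoldsTable (X j) (M + 1) s) := by
  refine Realizes.fill (fun j => (X j).order_pos) (fun j => (X j).idx) (by omega) _ _ le_rfl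
    (fun j x => (X j).faceCell x) (fun j x => ((X j).coSyndrome (φ j) x).val)
    (fun j => (X j).faceCell_injective)
    (fun j x => zmod_two_val_lt_pow (X j).order_pos le_rfl _) ?_ ?_
  · rintro j s ⟨hp, h2, hl, ht⟩
    refine ⟨hp.order, hp.bounded, ?_⟩
    rintro g ⟨a, b⟩ s' ha hr
    have hq : s'.reg (M + 1) = (X j).order := by rw [ha.1 _ (by omega), hp.order]
    have hg : (Expr.get M).eval s' = (X j).idx g := hr
    have ht1 : HoldsTable (X j) 1 s' := by
      unfold HoldsTable
      rw [ha.2 1 (by omega), hp.mem 1 (by omega) (by omega)]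
      exact holdsTable_start _
    have hA : (Expr.read 0 (tableAddr Δ (.get M) a)).eval s' = (X j).idx ((X j).a a * g) := by
      rw [Expr.eval, eval_tableAddr _ hg, ha.2 0 (by omega), hp.mem 0 (by omega) (by omega)]
      exact start_mem_zero _ _ _
    have hcorner : ∀ k l, (cornerExpr Δ M k l a b).eval s' = (X j).idx
        ((if l then (if k then (X j).a a * g else g) * (X j).b b else
          (if k then (X j).a a * g else g))) := by
      rintro (_ | _) (_ | _)
      · exact hg
      · exact eval_read_table ht1 hg b
      · exact hA
      · exact eval_read_table ht1 hA b
    refine ⟨eval_faceAddr _ hg a b, ?_⟩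
    refine Expr.eval_bool _ _ (b := fun x : Bool × Bool => φ j (x.1, x.2,
      if x.2 then (if x.1 then (X j).a a * g else g) * (X j).b b else
          (if x.1 then (X j).a a * g else g)) a b) fun x => ?_
    rw [Expr.eval, eval_vertexAddr _ hq (hcorner x.1 x.2)]
    exact hl.congr ha (by omega) _ _ _ _ _
  · rintro j s s' ⟨hp, h2, hl, ht⟩ hb ha hc hu
    refine ⟨hp.congr ha (by omega) hb, ?_, hl.congr ha (by omega), ht.congr ha (by omega)⟩
    ext i
    by_cases h : ∃ x, (X j).faceCell x = i
    · obtain ⟨x, rfl⟩ := h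
      rw [hc x, faceArray, (X j).faceCell_injective.extend_apply]
    · rw [hu i fun x hx => h ⟨_, hx.symm⟩, h2, faceArray, Function.extend_apply' _ _ _ h]

end Preprocessing

/-- Below `M` the memory is exactly an initial state of the co-decoder, so `Run.frame` transfers its
run. The data stored from `M` on are untouched. -/
theorem realizes_coDecoder {Δ ka kb : ℕ} {J : Type*} (X : J → LRCayley.{u} Δ)
    (φ : ∀ j, (X j).Vertex → Matrix (Fin Δ) (Fin Δ) (ZMod 2)) {M : ℕ} (hM : 5 ≤ M) {P : Cmd}
    (hPM : P.names ≤ M) {K : ℕ} (hK : 1 ≤ K) (c : ∀ j, (X j).EdgeBit ka kb → ZMod 2)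
    (hP : ∀ j, ∃ σ t, Run (((X j).order + 1) ^ K) P
      ((X j).start ((X j).faceArray ((X j).coSyndrome (φ j)))) σ t ∧ t ≤ K * (X j).order ∧
        (X j).Outputs σ (c j)) :
    Realizes (fun j => (X j).order) P
      (fun j s => Prepared (X j) M s ∧
        s.mem 2 = (X j).faceArray ((X j).coSyndrome (φ j)) ∧
        HoldsLocal (X j) (M + 2) (φ j) s ∧ HoldsTable (X j) (M + 1) s)
      (fun j s => s.reg (M + 1) = (X j).order ∧ Bounded (((X j).order + 1) ^ K) s ∧
        HoldsLocal (X j) (M + 2) (φ j) s ∧ HoldsTable (X j) (M + 1) s ∧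
        (X j).Outputs s (c j)) := by
  refine ⟨K, K, fun j s ⟨hp, h2, hl, ht⟩ K' hK' => ?_⟩
  obtain ⟨σ, t, hrun, htime, hout⟩ := hP j
  have hag : AgreeBelow M ((X j).start ((X j).faceArray ((X j).coSyndrome (φ j)))) s := by
    refine ⟨hp.reg, fun m hm => ?_⟩
    by_cases hm2 : m = 2
    · subst hm2; exact h2
    · rw [hp.mem m hm hm2]
      match m with
      | 0 => rfl
      | 1 => rfl
      | 2 => exact absurd rfl hm2
      | m + 3 => rfl
  obtain ⟨s', hrun', hag', hfrom⟩ := hrun.frame hPM s hag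
  have hn : 0 < (X j).order + 1 := Nat.succ_pos _
  refine ⟨s', t, hrun'.mono (Nat.pow_le_pow_right hn hK'), htime, ?_,
    hrun'.bounded (hp.bounded.mono (Nat.pow_le_pow_right hn hK)), ?_, ?_, ?_⟩
  · rw [hfrom.1 _ (by omega), hp.order]
  · unfold HoldsLocal; rw [hfrom.2 _ (by omega)]; exact hl
  · unfold HoldsTable; rw [hfrom.2 _ (by omega)]; exact ht
  · unfold Outputs
    rw [hag'.2 3 (by omega), hag'.2 4 (by omega)]
    exact hout

/-! ### Programs that turn the answer of the co-decoder into the decoded chain -/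

section Postprocessing

variable {Δ ma mb ka kb : ℕ} {J : Type*} (X : J → LRCayley.{u} Δ)
  (φ : ∀ j, (X j).Vertex → Matrix (Fin Δ) (Fin Δ) (ZMod 2))
  (HA : Matrix (Fin ma) (Fin Δ) (ZMod 2)) (HB : Matrix (Fin mb) (Fin Δ) (ZMod 2))
  (HA' : Matrix (Fin ka) (Fin Δ) (ZMod 2)) (HB' : Matrix (Fin kb) (Fin Δ) (ZMod 2))
  (M : ℕ) {K : ℕ}

/-- Fill array `M + 3` with the corrected local values at `V_{00}`. -/
noncomputable def midCmd : Cmd :=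
  fill (β := Fin Δ × Fin Δ) (M + 1) M (M + 3) (fun b => faceAddr Δ (.get M) b.1 b.2)
    (fun b => Expr.bool (ι := Unit ⊕ Fin ka ⊕ Fin kb)
      (fun x => match x with
        | .inl _ => .read (M + 2) (vertexAddr (M + 1) Δ Δ false false (.get M) b.1 b.2)
        | .inr (.inl p) => .read 3 (edgeAddr (M + 1) Δ ka false (.get M) b.2 p)
        | .inr (.inr p) => .read 4 (edgeAddr (M + 1) Δ kb false (.get M) b.1 p))
      (fun x => x (.inl ()) + (∑ p, HA' p b.1 * x (.inr (.inl p)) +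
        ∑ p, HB' p b.2 * x (.inr (.inr p)))))

theorem realizes_mid (hK : 1 ≤ K) (c : ∀ j, (X j).EdgeBit ka kb → ZMod 2) (hM : 5 ≤ M) :
    Realizes (fun j => (X j).order) (midCmd HA' HB' M)
      (fun j s => s.reg (M + 1) = (X j).order ∧ Bounded (((X j).order + 1) ^ K) s ∧
        HoldsLocal (X j) (M + 2) (φ j) s ∧ HoldsTable (X j) (M + 1) s ∧
        (X j).Outputs s (c j))
      (fun j s => s.reg (M + 1) = (X j).order ∧ Bounded (((X j).order + 1) ^ K) s ∧
        HoldsLocal (X j) (M + 2) (φ j) s ∧ HoldsTable (X j) (M + 1) s ∧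
        HoldsFaces (X j) (M + 3) ((X j).midFaces HA' HB' (φ j) (c j)) s) := by
  refine Realizes.fill (fun j => (X j).order_pos) (fun j => (X j).idx) (by omega) _ _ hK
    (fun j x => (X j).faceCell x) (fun j x => ((X j).midFaces HA' HB' (φ j) (c j) x).val)
    (fun j => (X j).faceCell_injective)
    (fun j x => zmod_two_val_lt_pow (X j).order_pos hK _) ?_ ?_
  · rintro j s ⟨hr, hb, hl, ht, ho⟩
    refine ⟨hr, hb, ?_⟩
    rintro g ⟨a, b⟩ s' ha hg
    have hq : s'.reg (M + 1) = (X j).order := by rw [ha.1 _ (by omega), hr]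
    replace hg : (Expr.get M).eval s' = (X j).idx g := hg
    refine ⟨eval_faceAddr _ hg a b, ?_⟩
    refine Expr.eval_bool _ _ (b := fun x : Unit ⊕ Fin ka ⊕ Fin kb => match x with
      | .inl _ => φ j (false, false, g) a b
      | .inr (.inl p) => c j (Sum.inl ((false, g, b), p))
      | .inr (.inr p) => c j (Sum.inr ((false, g, a), p))) fun x => ?_
    rcases x with _ | p | p
    · rw [Expr.eval, eval_vertexAddr _ hq hg]
      exact hl.congr ha (by omega) _ _ _ _ _
    · rw [Expr.eval, eval_edgeAddr _ hq hg, ha.2 3 (by omega)]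
      exact ho.1 _
    · rw [Expr.eval, eval_edgeAddr _ hq hg, ha.2 4 (by omega)]
      exact ho.2 _
  · rintro j s s' ⟨hr, hb, hl, ht, ho⟩ hb' ha hc hu
    exact ⟨by rw [ha.1 _ (by omega), hr], hb', hl.congr ha (by omega), ht.congr ha (by omega),
      fun g a b => hc (g, a, b)⟩

/-- Write the decoded chain on the horizontal edges into array `3`. -/
noncomputable def hOutCmd : Cmd :=
  fill (β := Bool × Fin Δ × Fin ma) (M + 1) M 3
    (fun b => edgeAddr (M + 1) Δ ma b.1 (.get M) b.2.1 b.2.2)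
    (fun b => Expr.bool (ι := Fin Δ)
      (fun i => if b.1 then .read (M + 2) (vertexAddr (M + 1) Δ Δ true false (.get M) i b.2.1)
        else .read (M + 3) (faceAddr Δ (.get M) i b.2.1))
      (fun x => ∑ i, HA b.2.2 i * x i))

/-- Overwriting array `3` is harmless: the co-decoder's answer has already been absorbed into array
`M + 3`. -/
theorem realizes_hOut (hK : 1 ≤ K) (u : ∀ j, (X j).Face → ZMod 2) (hM : 5 ≤ M) :
    Realizes (fun j => (X j).order) (hOutCmd HA M)
      (fun j s => s.reg (M + 1) = (X j).order ∧ Bounded (((X j).order + 1) ^ K) s ∧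
        HoldsLocal (X j) (M + 2) (φ j) s ∧ HoldsTable (X j) (M + 1) s ∧
        HoldsFaces (X j) (M + 3) (u j) s)
      (fun j s => s.reg (M + 1) = (X j).order ∧ Bounded (((X j).order + 1) ^ K) s ∧
        HoldsLocal (X j) (M + 2) (φ j) s ∧ HoldsTable (X j) (M + 1) s ∧
        HoldsFaces (X j) (M + 3) (u j) s ∧
        HoldsEdges (X j) 3 (fun x => (X j).outChain HA HB (φ j) (u j) (Sum.inl x)) s) := by
  refine Realizes.fill (fun j => (X j).order_pos) (fun j => (X j).idx) (by omega) _ _ hK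
    (fun j x => (X j).edgeCell ma ((x.2.1, x.1, x.2.2.1), x.2.2.2))
    (fun j x => ((X j).outChain HA HB (φ j) (u j)
      (Sum.inl ((x.2.1, x.1, x.2.2.1), x.2.2.2))).val) (fun j => ?_)
    (fun j x => zmod_two_val_lt_pow (X j).order_pos hK _) ?_ ?_
  · rintro ⟨g, k, l, a⟩ ⟨g', k', l', a'⟩ h
    have := (X j).edgeCell_injective _ h
    simp only [Prod.mk.injEq] at this ⊢
    tauto
  · rintro j s ⟨hr, hb, hl, ht, hf⟩
    refine ⟨hr, hb, ?_⟩
    rintro g ⟨k, t, p⟩ s' ha hg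
    have hq : s'.reg (M + 1) = (X j).order := by rw [ha.1 _ (by omega), hr]
    replace hg : (Expr.get M).eval s' = (X j).idx g := hg
    refine ⟨eval_edgeAddr _ hq hg k t p, ?_⟩
    cases k
    · refine Expr.eval_bool _ _ (b := fun i => u j (g, i, t)) fun i => ?_
      simp only [Bool.false_eq_true, if_false]
      rw [Expr.eval, eval_faceAddr _ hg]
      exact hf.congr ha (by omega) _ _ _
    · refine Expr.eval_bool _ _ (b := fun i => φ j (true, false, g) i t) fun i => ?_
      simp only [if_true]
      rw [Expr.eval, eval_vertexAddr _ hq hg]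
      exact hl.congr ha (by omega) _ _ _ _ _
  · rintro j s s' ⟨hr, hb, hl, ht, hf⟩ hb' ha hc hu
    exact ⟨by rw [ha.1 _ (by omega), hr], hb', hl.congr ha (by omega), ht.congr ha (by omega),
      hf.congr ha (by omega), fun ⟨⟨k, g, t⟩, p⟩ => hc (g, k, t, p)⟩

/-- Write the decoded chain on the vertical edges into array `4`. -/
noncomputable def vOutCmd : Cmd :=
  fill (β := Bool × Fin Δ × Fin mb) (M + 1) M 4
    (fun b => edgeAddr (M + 1) Δ mb b.1 (.get M) b.2.1 b.2.2)
    (fun b => if b.1 then Expr.bool (ι := Fin Δ ⊕ Fin Δ)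
      (fun x => match x with
        | .inl t => .read (M + 2) (vertexAddr (M + 1) Δ Δ false true (.get M) b.2.1 t)
        | .inr t => .read (M + 3) (faceAddr Δ (preimageB Δ (M + 1) (.get M) t) b.2.1 t))
      (fun x => ∑ t, HB b.2.2 t * (x (.inl t) + x (.inr t))) else .lit 0)

theorem realizes_vOut (hK : 1 ≤ K) (u : ∀ j, (X j).Face → ZMod 2) (hM : 5 ≤ M) :
    Realizes (fun j => (X j).order) (vOutCmd HB M)
      (fun j s => s.reg (M + 1) = (X j).order ∧ Bounded (((X j).order + 1) ^ K) s ∧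
        HoldsLocal (X j) (M + 2) (φ j) s ∧ HoldsTable (X j) (M + 1) s ∧
        HoldsFaces (X j) (M + 3) (u j) s ∧
        HoldsEdges (X j) 3 (fun x => (X j).outChain HA HB (φ j) (u j) (Sum.inl x)) s)
      (fun j s => (X j).Outputs s ((X j).outChain HA HB (φ j) (u j))) := by
  refine Realizes.fill (fun j => (X j).order_pos) (fun j => (X j).idx) (by omega) _ _ hK
    (fun j x => (X j).edgeCell mb ((x.2.1, x.1, x.2.2.1), x.2.2.2))
    (fun j x => ((X j).outChain HA HB (φ j) (u j)
      (Sum.inr ((x.2.1, x.1, x.2.2.1), x.2.2.2))).val) (fun j => ?_)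
    (fun j x => zmod_two_val_lt_pow (X j).order_pos hK _) ?_ ?_
  · rintro ⟨g, k, l, a⟩ ⟨g', k', l', a'⟩ h
    have := (X j).edgeCell_injective _ h
    simp only [Prod.mk.injEq] at this ⊢
    tauto
  · rintro j s ⟨hr, hb, hl, ht, hf, -⟩
    refine ⟨hr, hb, ?_⟩
    rintro g ⟨l, i, p⟩ s' ha hg
    have hq : s'.reg (M + 1) = (X j).order := by rw [ha.1 _ (by omega), hr]
    replace hg : (Expr.get M).eval s' = (X j).idx g := hg
    refine ⟨eval_edgeAddr _ hq hg l i p, ?_⟩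
    cases l
    -- The zeros on `E_{*0}` are really stored, since array `4` may still contain the co-decoder's
    -- answer.
    · rfl
    · simp only [if_true]
      refine Expr.eval_bool _ _ (b := fun x : Fin Δ ⊕ Fin Δ => match x with
        | .inl t => φ j (false, true, g) i t
        | .inr t => u j (g * ((X j).b t)⁻¹, i, t)) fun x => ?_
      rcases x with t | t
      · rw [Expr.eval, eval_vertexAddr _ hq hg]
        exact hl.congr ha (by omega) _ _ _ _ _
      · rw [Expr.eval, eval_faceAddr _ (eval_preimageB (ht.congr ha (by omega)) hg t)]
        exact hf.congr ha (by omega) _ _ _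
  · rintro j s s' ⟨hr, hb, hl, ht, hf, ho⟩ hb' ha hc hu
    exact ⟨fun x => ho.congr ha (by omega) x, fun ⟨⟨k, g, t⟩, p⟩ => hc (g, k, t, p)⟩

end Postprocessing

end RAM

/-! ### Assembly of the decoder -/

theorem mainTheorem10 {Δ ma mb ka kb : ℕ} {ι : Type*} (X : ι → LRCayley.{u} Δ)
    (CA CB : Submodule (ZMod 2) (Fin Δ → ZMod 2))
    (HA : Matrix (Fin ma) (Fin Δ) (ZMod 2)) (HB : Matrix (Fin mb) (Fin Δ) (ZMod 2))
    (HA' : Matrix (Fin ka) (Fin Δ) (ZMod 2)) (HB' : Matrix (Fin kb) (Fin Δ) (ZMod 2))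
    (hA : IsParityCheck HA CA) (hB : IsParityCheck HB CB)
    (hA' : IsParityCheck HA' (dualCode CA)) (hB' : IsParityCheck HB' (dualCode CB))
    (d₂ : ℝ) (hd₂ : 0 < d₂) (hrob : IsRobust CA CB d₂) (η : ℝ)
    (hco : HasLinearTimeCoDecoder X HA' HB' (fun i => η * ((X i).order : ℝ))) :
    HasLinearTimeDecoder X HA HB
      (fun i => η / (6 + 4 * (Δ : ℝ) / d₂) * ((X i).order : ℝ)) := by
  obtain ⟨D, hD⟩ := LRCayley.exists_decoder (ka := ka) (kb := kb) hA hB hA' hB' hrob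
  obtain ⟨P, K₀, hP⟩ := hco
  -- An index records both the complex and the error, so that the constants in `Realizes` are
  -- uniform in both.
  let J := Σ i, {c : (X i).EdgeBit ma mb → ZMod 2 //
    ((X i).edgeWeight c : ℝ) ≤ η / (6 + 4 * (Δ : ℝ) / d₂) * ((X i).order : ℝ)}
  let Y : J → LRCayley.{u} Δ := fun j => X j.1
  let y : ∀ j : J, (Y j).VertexBit ma mb → ZMod 2 := fun j =>
    ((X j.1).bdry1 HA HB).mulVec j.2.1
  let φ : ∀ j : J, (Y j).Vertex → Matrix (Fin Δ) (Fin Δ) (ZMod 2) := fun j =>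
    (Y j).localFaces D (y j)
  have hco : ∀ j : J, ∃ c'' : (Y j).EdgeBit ka kb → ZMod 2,
      (∃ σ t, RAM.Run (((Y j).order + 1) ^ (K₀ + 1)) P
        ((Y j).start ((Y j).faceArray ((Y j).coSyndrome (φ j)))) σ t ∧
        t ≤ (K₀ + 1) * (Y j).order ∧ (Y j).Outputs σ c'') ∧
      ∃ w : (Y j).Face → ZMod 2,
        (Y j).outChain HA HB (φ j) ((Y j).midFaces HA' HB' (φ j) c'') =
          j.2.1 + ((X j.1).bdry2 HA HB).mulVec w := by
    rintro ⟨i, c, hc⟩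
    obtain ⟨c', hsyn, hweight, hout⟩ := hD (X i) c
    have hle : ((X i).edgeWeight c' : ℝ) ≤ η * (X i).order := by
      have h1 := hweight hd₂
      have hpos : 0 < 6 + 4 * (Δ : ℝ) / d₂ := by positivity
      have h2 : (6 + 4 * (Δ : ℝ) / d₂) * ((X i).edgeWeight c : ℝ) ≤ η * (X i).order := by
        rw [div_mul_eq_mul_div, le_div_iff₀ hpos] at hc
        linarith
      have h3 : ((X i).edgeWeight c' : ℝ) ≤ 4 * (Δ : ℝ) / d₂ * ((X i).edgeWeight c : ℝ) := by
        rw [div_mul_eq_mul_div, le_div_iff₀ hd₂]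
        linarith
      -- The argument needs only the summand `4Δ/d₂`; the `6` is slack, dropped because the weight
      -- is non-negative.
      have h4 : (0 : ℝ) ≤ (X i).edgeWeight c := Nat.cast_nonneg _
      linarith
    obtain ⟨σ, t, hrun, ht, c'', hc'', z, hz⟩ := hP i c' hle
    rw [hsyn] at hrun
    refine ⟨c'', ⟨σ, t, hrun.mono (Nat.pow_le_pow_right (Nat.succ_pos _) (Nat.le_succ _)),
      ht.trans (Nat.mul_le_mul_right _ (Nat.le_succ _)), hc''⟩, ?_⟩
    rw [hz]
    exact hout z
  choose c'' hrun w hw using hco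
  -- Private memory starts beyond all names in `P` and beyond the input and output arrays `0` to
  -- `4`.
  have hM : 5 ≤ P.names + 5 := by omega
  -- An exponent of at least one is needed to bound the initial memory, which contains `|G|`.
  have hK : 1 ≤ K₀ + 1 := by omega
  suffices ∃ C, RAM.Realizes (fun j => (Y j).order) C
      (fun j s => s = (Y j).start ((Y j).vertexArray (y j)))
      (fun j s => (Y j).Outputs s
        ((Y j).outChain HA HB (φ j) ((Y j).midFaces HA' HB' (φ j) (c'' j)))) by
    obtain ⟨C, K, T, h⟩ := this
    refine ⟨C, K + T, fun i c hc => ?_⟩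
    obtain ⟨σ, t, hσ, ht, ho⟩ := h ⟨i, c, hc⟩ _ rfl (K + T) (Nat.le_add_right _ _)
    exact ⟨σ, t, hσ, ht.trans (Nat.mul_le_mul_right _ (Nat.le_add_left _ _)), _, ho,
      w ⟨i, c, hc⟩, hw ⟨i, c, hc⟩⟩
  exact ⟨_, (RAM.realizes_init Y y (P.names + 5)).seq <|
    (RAM.realizes_local Y y D _ hM).seq <|
    (RAM.realizes_table Y y _ φ hM).seq <| (RAM.realizes_clear Y y _ φ hM).seq <|
    (RAM.realizes_coSyndrome Y _ φ hM).seq <|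
    (RAM.realizes_coDecoder Y φ hM (Nat.le_add_right _ _) hK c'' hrun).seq <|
    (RAM.realizes_mid Y φ HA' HB' _ hK c'' hM).seq <|
    (RAM.realizes_hOut Y φ HA HB _ hK (fun j => (Y j).midFaces HA' HB' (φ j) (c'' j)) hM).seq
    (RAM.realizes_vOut Y φ HA HB _ hK _ hM)⟩
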